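/- Conventions. Products $\times$ and smash products $\wedge$ are formed in compactly generated spaces (the product carries the compactly generated topology associated with the product topology, and $A\wedge B=(A\times B)/(A\vee B)$); maps and homotopies are pointed, and $[Y,X]$ is the set of pointed homotopy classes. Let $\Gamma$ be a co-grouplike space, i.e. a pointed space with a co-multiplication $\Gamma\to\Gamma\vee\Gamma$ which, up to homotopy, is co-unital, co-associative and has a co-inverse. Write $\Gamma A=\Gamma\wedge A$; it is again co-grouplike, so $[\Gamma A,X]$ is a group. For a space $W$ put $\tau^\Gamma_W(X)=[\Gamma(W\sqcup *),X]$. Write $(x,y)=xyx^{-1}y^{-1}$ and $x^y=yxy^{-1}$ in a group; group operations are written multiplicatively. Let $A,B,C$ be pointed spaces with the pointed homotopy type of well-pointed compactly generated Hausdorff spaces, $X$ a pointed space, and $\alpha\in[\Gamma A,X]$, $\beta\in[\Gamma B,X]$, $\gamma\in[\Gamma C,X]$. The $\Gamma$-Whitehead product $[\alpha,\beta]_\Gamma\in[\Gamma(A\wedge B),X]$ is the class whose image in $[\Gamma(A\times B),X]$ is the commutator $(p_A^*\alpha,p_B^*\beta)$, where $p_A,p_B$ are induced by the projections. For $a\in\tau^\Gamma_A(X)$,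 $b\in\tau^\Gamma_B(X)$, the product $[a,b]_\Gamma$ is regarded as an element of $\tau^\Gamma_{A\times B}(X)$ through $(A\sqcup *)\wedge(B\sqcup *)\cong(A\times B)\sqcup *$. For $\xi\in[\Gamma,X]=[\Gamma S^0,X]$ and $\eta\in[\Gamma W,X]$, $\eta^\xi\in[\Gamma W,X]$ is the class whose image in $\tau^\Gamma_W(X)$ is $\xi\eta\xi^{-1}$; here $[\Gamma,X]$ and $[\Gamma W,X]$ are mapped to $\tau^\Gamma_W(X)$ through $W\sqcup *\to S^0$ and $W\sqcup *\to W$. For $\xi\in[\Gamma V,X]$ put $\xi\cdot\eta=\eta^\xi$ if $V\cong S^0$ (so that $\Gamma V=\Gamma$ and $\xi\in[\Gamma,X]$), and $\xi\cdot\eta=\eta$ otherwise. For $i,j,k$ a permutation of $1,2,3$, let $t_{ijk}$ be the map that permutes three factors, of a product or of a smash product, $x_1,x_2,x_3\mapsto x_i,x_j,x_k$. Theorem. (0) These are well defined: for pointed spaces $P,Q,W$ with the pointed homotopy type of well-pointed compactly generated Hausdorff spaces, $P\wedge Q$ is again of this kind, there is exactly one class $[\mu,\nu]_\Gamma$ for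 all $\mu\in[\Gamma P,X]$, $\nu\in[\Gamma Q,X]$, and there is exactly one class $\eta^\xi$ for all $\xi\in[\Gamma,X]$, $\eta\in[\Gamma W,X]$. (1) Let $a,b,c$ be the images of $\alpha,\beta,\gamma$ in $\tau^\Gamma_A(X),\tau^\Gamma_B(X),\tau^\Gamma_C(X)$, and $\bar\alpha,\bar\beta,\bar\gamma$ their images in $\tau^\Gamma_{A\times B\times C}(X)$. Then in $\tau^\Gamma_{A\times B\times C}(X)$ $$\big((\Gamma t_{213})^*[[b^{-1},a]_\Gamma,c]_\Gamma\big)^{\bar\beta}\,\big((\Gamma t_{321})^*[[c^{-1},b]_\Gamma,a]_\Gamma\big)^{\bar\gamma}\,\big((\Gamma t_{132})^*[[a^{-1},c]_\Gamma,b]_\Gamma\big)^{\bar\alpha}=1,$$ and $[[b^{-1},a]_\Gamma,c]_\Gamma$, $[[c^{-1},b]_\Gamma,a]_\Gamma$, $[[a^{-1},c]_\Gamma,b]_\Gamma$ are the images in $\tau^\Gamma_{B\times A\times C}(X)$, $\tau^\Gamma_{C\times B\times A}(X)$, $\tau^\Gamma_{A\times C\times B}(X)$ of $[[\beta^{-1},\alpha]_\Gamma,\gamma]_\Gamma$,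 $[[\gamma^{-1},\beta]_\Gamma,\alpha]_\Gamma$, $[[\alpha^{-1},\gamma]_\Gamma,\beta]_\Gamma$. (2) If $\Gamma A$, $\Gamma B$ and $\Gamma C$ are homotopy co-commutative, then in $[\Gamma(A\wedge B\wedge C),X]$ (where the operation is usually written additively) $$[[\alpha,\beta]_\Gamma,\gamma]_\Gamma\cdot(\Gamma t_{312})^*[[\gamma,\alpha]_\Gamma,\beta]_\Gamma\cdot(\Gamma t_{231})^*[[\beta,\gamma]_\Gamma,\alpha]_\Gamma=1.$$ (3) If each of $A,B,C$ is homeomorphic, as a pointed space, to $S^0$ or has a homotopy co-commutative $\Gamma A$, respectively $\Gamma B$, $\Gamma C$, then in $[\Gamma(A\wedge B\wedge C),X]$ $$(\Gamma t_{213})^*\big(\beta\cdot[[\beta^{-1},\alpha]_\Gamma,\gamma]_\Gamma\big)\;(\Gamma t_{321})^*\big(\gamma\cdot[[\gamma^{-1},\beta]_\Gamma,\alpha]_\Gamma\big)\;(\Gamma t_{132})^*\big(\alpha\cdot[[\alpha^{-1},\gamma]_\Gamma,\beta]_\Gamma\big)=1.$$ -/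

import Mathlib

universe u v w

namespace GammaFox

open TopologicalSpace unitInterval

/-! ## Pointed spaces, pointed maps, pointed homotopy classes -/

/-- A topological space with a base point. -/
structure PTop : Type (u + 1) where
  carrier : Type u
  [top : TopologicalSpace carrier]
  pt : carrier

instance : CoeSort PTop.{u} (Type u) := ⟨PTop.carrier⟩

instance (X : PTop.{u}) : TopologicalSpace X := X.top

/-- Base point preserving continuous maps. -/
@[ext]
structure PMap (X : PTop.{u}) (Y : PTop.{v}) where
  toMap : C(X, Y)
  map_pt : toMap X.pt = Y.pt

instance (X : PTop.{u}) (Y : PTop.{v}) : CoeFun (PMap X Y) (fun _ => X → Y) :=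
  ⟨fun f => f.toMap⟩

namespace PMap

variable {X : PTop.{u}} {Y : PTop.{v}} {Z : PTop.{w}}

theorem ext_fun {f g : PMap X Y} (h : ∀ x, f x = g x) : f = g :=
  PMap.ext (ContinuousMap.ext h)

theorem cont (f : PMap X Y) : Continuous f := f.toMap.continuous

/-- The identity. -/
def id (X : PTop.{u}) : PMap X X := ⟨ContinuousMap.id X, rfl⟩

/-- Composition, `(g.comp f) x = g (f x)`. -/
def comp (g : PMap Y Z) (f : PMap X Y) : PMap X Z :=
  ⟨g.toMap.comp f.toMap, by
    show g (f X.pt) = Z.pt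
    rw [f.map_pt, g.map_pt]⟩

/-- The constant map at the base point. -/
def const (X : PTop.{u}) (Y : PTop.{v}) : PMap X Y :=
  ⟨ContinuousMap.const X Y.pt, rfl⟩

/-- Homotopy of pointed maps through pointed maps. -/
def Homotopic (f g : PMap X Y) : Prop :=
  ContinuousMap.HomotopicRel f.toMap g.toMap {X.pt}

theorem homotopic_iff {f g : PMap X Y} :
    f.Homotopic g ↔ ∃ H : I × X → Y, Continuous H ∧ (∀ x, H (0, x) = f x) ∧
      (∀ x, H (1, x) = g x) ∧ ∀ t, H (t, X.pt) = Y.pt := by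
  constructor
  · rintro ⟨H⟩
    refine ⟨H, H.continuous, fun x => H.apply_zero x, fun x => H.apply_one x, fun t => ?_⟩
    rw [H.eq_fst t rfl]
    exact f.map_pt
  · rintro ⟨H, hc, h0, h1, hp⟩
    refine ⟨⟨⟨⟨H, hc⟩, h0, h1⟩, ?_⟩⟩
    rintro t x rfl
    exact (hp t).trans f.map_pt.symm

theorem Homotopic.refl (f : PMap X Y) : f.Homotopic f :=
  ContinuousMap.HomotopicRel.refl f.toMap

theorem Homotopic.comp {f f' : PMap X Y} {g g' : PMap Y Z} (hg : g.Homotopic g')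
    (hf : f.Homotopic f') : (g.comp f).Homotopic (g'.comp f') := by
  obtain ⟨H, hH, h0, h1, hp⟩ := homotopic_iff.1 hf
  obtain ⟨K, hK, k0, k1, kp⟩ := homotopic_iff.1 hg
  refine homotopic_iff.2 ⟨fun p => K (p.1, H p), by fun_prop, fun x => ?_, fun x => ?_,
    fun t => ?_⟩
  · show K (0, H (0, x)) = _
    rw [h0, k0]; rfl
  · show K (1, H (1, x)) = _
    rw [h1, k1]; rfl
  · show K (t, H (t, X.pt)) = _
    rw [hp, kp]

instance setoid (X : PTop.{u}) (Y : PTop.{v}) : Setoid (PMap X Y) where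
  r := Homotopic
  iseqv := ⟨fun f => ContinuousMap.HomotopicRel.refl f.toMap,
    fun h => ContinuousMap.HomotopicRel.symm h,
    fun h k => ContinuousMap.HomotopicRel.trans h k⟩

end PMap

/-- The set `[X, Y]` of pointed homotopy classes of pointed maps. -/
def HClass (X : PTop.{u}) (Y : PTop.{v}) : Type (max u v) := Quotient (PMap.setoid X Y)

/-- The map `f^* : [Y, Z] → [X, Z]` given by precomposition with `f : X → Y`. -/
def HClass.pull {X : PTop.{u}} {Y : PTop.{v}} {Z : PTop.{w}} (f : PMap X Y) :
    HClass Y Z → HClass X Z :=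
  Quotient.map (fun g => g.comp f) (fun _ _ h => h.comp (PMap.Homotopic.refl f))

/-- Having the same pointed homotopy type. -/
def PHomotopyEquivalent (X : PTop.{u}) (Y : PTop.{v}) : Prop :=
  ∃ (f : PMap X Y) (g : PMap Y X),
    (g.comp f).Homotopic (PMap.id X) ∧ (f.comp g).Homotopic (PMap.id Y)

/-- Well-pointed: the base point is closed and its inclusion is a cofibration, i.e. the subspace
`X × {0} ∪ {pt} × [0, 1]` is a retract of the cylinder `X × [0, 1]`. -/
def WellPointed (X : PTop.{u}) : Prop :=
  IsClosed ({X.pt} : Set X) ∧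
    ∃ r : C(X × I, X × I), (∀ p, (r p).2 = 0 ∨ (r p).1 = X.pt) ∧
      ∀ p : X × I, p.2 = 0 ∨ p.1 = X.pt → r p = p

/-- The pointed space has the pointed homotopy type of a well-pointed compactly generated
Hausdorff space. -/
def HasCGHType (X : PTop.{u}) : Prop :=
  ∃ Y : PTop.{u}, T2Space Y ∧ CompactlyGeneratedSpace Y ∧ WellPointed Y ∧
    PHomotopyEquivalent X Y

/-! ## Wedges and co-grouplike spaces -/

section Wedge

variable {X X' Y Y' : PTop.{u}} {Z : PTop.{v}}

/-- The wedge `X ∨ Y`, as the subspace of `X × Y` of the points with at least one coordinate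
at the base point (for two spaces this is homeomorphic to the quotient of the disjoint union
that identifies the base points). -/
def wedge (X Y : PTop.{u}) : PTop.{u} :=
  ⟨{p : X × Y // p.1 = X.pt ∨ p.2 = Y.pt}, ⟨(X.pt, Y.pt), Or.inl rfl⟩⟩

/-- The pinch onto the first summand. -/
def wedgeFst (X Y : PTop.{u}) : PMap (wedge X Y) X :=
  ⟨⟨fun p => p.1.1, continuous_fst.comp continuous_subtype_val⟩, rfl⟩

/-- The pinch onto the second summand. -/
def wedgeSnd (X Y : PTop.{u}) : PMap (wedge X Y) Y :=
  ⟨⟨fun p => p.1.2, continuous_snd.comp continuous_subtype_val⟩, rfl⟩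

/-- `f ∨ g`. -/
def wedgeMap (f : PMap X X') (g : PMap Y Y') : PMap (wedge X Y) (wedge X' Y') :=
  ⟨⟨fun p => ⟨(f p.1.1, g p.1.2), p.2.imp (fun h => by
      show f p.1.1 = _
      rw [h, f.map_pt]) (fun h => by
      show g p.1.2 = _
      rw [h, g.map_pt])⟩,
    Continuous.subtype_mk ((f.cont.comp (continuous_fst.comp continuous_subtype_val)).prodMk
      (g.cont.comp (continuous_snd.comp continuous_subtype_val))) _⟩,
    Subtype.ext (Prod.ext f.map_pt g.map_pt)⟩

/-- The interchange of the two summands. -/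
def wedgeSwap (X Y : PTop.{u}) : PMap (wedge X Y) (wedge Y X) :=
  ⟨⟨fun p => ⟨(p.1.2, p.1.1), p.2.symm⟩,
    Continuous.subtype_mk ((continuous_snd.comp continuous_subtype_val).prodMk
      (continuous_fst.comp continuous_subtype_val)) _⟩, rfl⟩

/-- `(X ∨ X) ∨ X → X ∨ (X ∨ X)`. -/
def wedgeAssoc (X : PTop.{u}) : PMap (wedge (wedge X X) X) (wedge X (wedge X X)) :=
  ⟨⟨fun p => ⟨(p.1.1.1.1, ⟨(p.1.1.1.2, p.1.2), by
      rcases p.2 with h | h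
      · exact Or.inl (congrArg (fun q : wedge X X => q.1.2) h)
      · exact Or.inr h⟩), by
      rcases p.2 with h | h
      · exact Or.inl (congrArg (fun q : wedge X X => q.1.1) h)
      · rcases p.1.1.2 with h' | h'
        · exact Or.inl h'
        · exact Or.inr (Subtype.ext (Prod.ext h' h))⟩, by
      refine Continuous.subtype_mk (Continuous.prodMk ?_ (Continuous.subtype_mk
        (Continuous.prodMk ?_ ?_) _)) _
      · exact continuous_fst.comp (continuous_subtype_val.comp
          (continuous_fst.comp continuous_subtype_val))
      · exact continuous_snd.comp (continuous_subtype_val.comp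
          (continuous_fst.comp continuous_subtype_val))
      · exact continuous_snd.comp continuous_subtype_val⟩, rfl⟩

open Classical in
/-- The underlying function of the folding map: `(x, *) ↦ x`, `(*, y) ↦ y`. -/
noncomputable def foldFun (Z : PTop.{v}) (p : wedge Z Z) : Z :=
  if p.1.2 = Z.pt then p.1.1 else p.1.2

theorem foldFun_fst {p : wedge Z Z} (h : p.1.1 = Z.pt) : foldFun Z p = p.1.2 := by
  unfold foldFun
  split_ifs with h'
  · rw [h, h']
  · rfl

theorem foldFun_snd {p : wedge Z Z} (h : p.1.2 = Z.pt) : foldFun Z p = p.1.1 := if_pos h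

theorem continuous_foldFun (Z : PTop.{v}) : Continuous (foldFun Z) := by
  have c1 : Continuous fun p : wedge Z Z => p.1.1 := (wedgeFst Z Z).cont
  have c2 : Continuous fun p : wedge Z Z => p.1.2 := (wedgeSnd Z Z).cont
  refine continuous_iff_continuousAt.2 fun p => ?_
  refine tendsto_nhds.2 fun U hU hp => ?_
  by_cases hz : Z.pt ∈ U
  · have h1 : p.1.1 ∈ U := by
      rcases p.2 with h | h
      · rw [h]; exact hz
      · rw [← foldFun_snd h]; exact hp
    have h2 : p.1.2 ∈ U := by
      rcases p.2 with h | h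
      · rw [← foldFun_fst h]; exact hp
      · rw [h]; exact hz
    filter_upwards [(hU.preimage c1).mem_nhds h1, (hU.preimage c2).mem_nhds h2] with q q1 q2
    rcases q.2 with h | h
    · show foldFun Z q ∈ U
      rw [foldFun_fst h]; exact q2
    · show foldFun Z q ∈ U
      rw [foldFun_snd h]; exact q1
  · rcases p.2 with h | h
    · have h2 : p.1.2 ∈ U := by rw [← foldFun_fst h]; exact hp
      filter_upwards [(hU.preimage c2).mem_nhds h2] with q q2
      rcases q.2 with h | h
      · show foldFun Z q ∈ U
        rw [foldFun_fst h]; exact q2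
      · exact absurd (h ▸ q2 : Z.pt ∈ U) hz
    · have h1 : p.1.1 ∈ U := by rw [← foldFun_snd h]; exact hp
      filter_upwards [(hU.preimage c1).mem_nhds h1] with q q1
      rcases q.2 with h | h
      · exact absurd (h ▸ q1 : Z.pt ∈ U) hz
      · show foldFun Z q ∈ U
        rw [foldFun_snd h]; exact q1

/-- The folding map `Z ∨ Z → Z`. -/
noncomputable def fold (Z : PTop.{v}) : PMap (wedge Z Z) Z :=
  ⟨⟨foldFun Z, continuous_foldFun Z⟩, foldFun_fst rfl⟩

end Wedge

/-- A co-grouplike space: a pointed space with a co-multiplication that is co-unital,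
co-associative and has a co-inverse, each up to pointed homotopy. -/
class CoGroup (Z : PTop.{u}) where
  /-- the co-multiplication -/
  comul : PMap Z (wedge Z Z)
  /-- the co-inverse -/
  coinv : PMap Z Z
  counit_left : ((wedgeSnd Z Z).comp comul).Homotopic (PMap.id Z)
  counit_right : ((wedgeFst Z Z).comp comul).Homotopic (PMap.id Z)
  coassoc : ((wedgeAssoc Z).comp ((wedgeMap comul (PMap.id Z)).comp comul)).Homotopic
    ((wedgeMap (PMap.id Z) comul).comp comul)
  coinv_left : ((fold Z).comp ((wedgeMap coinv (PMap.id Z)).comp comul)).Homotopic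
    (PMap.const Z Z)
  coinv_right : ((fold Z).comp ((wedgeMap (PMap.id Z) coinv).comp comul)).Homotopic
    (PMap.const Z Z)

/-- Homotopy co-commutativity of the co-multiplication. -/
def HomotopyCocommutative (Z : PTop.{u}) [CoGroup Z] : Prop :=
  ((wedgeSwap Z Z).comp (CoGroup.comul (Z := Z))).Homotopic (CoGroup.comul (Z := Z))

/-! ### The group `[Z, X]` for a co-grouplike space `Z` -/

section Group

variable {Z Z' : PTop.{u}} {X Y : PTop.{v}}

/-- `(f, g) : Z ∨ Z' → X`, equal to `f` on `Z` and to `g` on `Z'`. -/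
noncomputable def copairFun (f : Z → X) (g : Z' → X) (hf : f Z.pt = X.pt) (hg : g Z'.pt = X.pt)
    (p : wedge Z Z') : X :=
  foldFun X ⟨(f p.1.1, g p.1.2), p.2.imp (fun h => by show f p.1.1 = _; rw [h, hf])
    (fun h => by show g p.1.2 = _; rw [h, hg])⟩

/-- `(f, g) : Z ∨ Z' → X`, equal to `f` on `Z` and to `g` on `Z'`. -/
noncomputable def copair (f : PMap Z X) (g : PMap Z' X) : PMap (wedge Z Z') X :=
  ⟨⟨copairFun f g f.map_pt g.map_pt, (continuous_foldFun X).comp (Continuous.subtype_mk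
    ((f.cont.comp (wedgeFst Z Z').cont).prodMk (g.cont.comp (wedgeSnd Z Z').cont)) _)⟩,
    (foldFun_fst f.map_pt).trans g.map_pt⟩

theorem copair_left (f : PMap Z X) (g : PMap Z' X) {p : wedge Z Z'} (h : p.1.2 = Z'.pt) :
    copair f g p = f p.1.1 :=
  foldFun_snd (by show g p.1.2 = _; rw [h, g.map_pt])

theorem copair_right (f : PMap Z X) (g : PMap Z' X) {p : wedge Z Z'} (h : p.1.1 = Z.pt) :
    copair f g p = g p.1.2 :=
  foldFun_fst (by show f p.1.1 = _; rw [h, f.map_pt])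

theorem copair_const_left (g : PMap Z' X) (p : wedge Z Z') :
    copair (PMap.const Z X) g p = g p.1.2 := foldFun_fst rfl

theorem copair_const_right (f : PMap Z X) (p : wedge Z Z') :
    copair f (PMap.const Z' X) p = f p.1.1 := foldFun_snd rfl

theorem copair_homotopic {f f' : PMap Z X} {g g' : PMap Z' X} (hf : f.Homotopic f')
    (hg : g.Homotopic g') : (copair f g).Homotopic (copair f' g') := by
  obtain ⟨H, hH, h0, h1, hp⟩ := PMap.homotopic_iff.1 hf
  obtain ⟨K, hK, k0, k1, kp⟩ := PMap.homotopic_iff.1 hg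
  have c1 := (wedgeFst Z Z').cont
  have c2 := (wedgeSnd Z Z').cont
  refine PMap.homotopic_iff.2 ⟨fun p => copairFun (fun x => H (p.1, x)) (fun x => K (p.1, x))
    (hp _) (kp _) p.2, ?_, fun x => ?_, fun x => ?_, fun t => ?_⟩
  · exact (continuous_foldFun X).comp (Continuous.subtype_mk
      ((hH.comp (continuous_fst.prodMk (c1.comp continuous_snd))).prodMk
        (hK.comp (continuous_fst.prodMk (c2.comp continuous_snd)))) _)
  · exact congrArg (foldFun X) (Subtype.ext (Prod.ext (h0 _) (k0 _)))
  · exact congrArg (foldFun X) (Subtype.ext (Prod.ext (h1 _) (k1 _)))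
  · exact (foldFun_fst (hp t)).trans (kp t)

theorem const_comp (f : PMap Z X) : f.comp (PMap.const Z Z) = PMap.const Z X :=
  PMap.ext_fun fun _ => f.map_pt

variable [CoGroup Z]

/-- The product of two maps, `Z → Z ∨ Z → X`. -/
noncomputable def mulMap (f g : PMap Z X) : PMap Z X := (copair f g).comp CoGroup.comul

theorem mulMap_homotopic {f f' g g' : PMap Z X} (hf : f.Homotopic f') (hg : g.Homotopic g') :
    (mulMap f g).Homotopic (mulMap f' g') :=
  (copair_homotopic hf hg).comp (PMap.Homotopic.refl _)

theorem mulMap_assoc (f g h : PMap Z X) :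
    (mulMap (mulMap f g) h).Homotopic (mulMap f (mulMap g h)) := by
  have key := (PMap.Homotopic.refl (copair f (copair g h))).comp (CoGroup.coassoc (Z := Z))
  have e1 : (copair f (copair g h)).comp ((wedgeAssoc Z).comp
      ((wedgeMap CoGroup.comul (PMap.id Z)).comp CoGroup.comul)) = mulMap (mulMap f g) h := by
    refine PMap.ext_fun fun z => ?_
    show (copair f (copair g h)) (wedgeAssoc Z (wedgeMap CoGroup.comul (PMap.id Z)
      (CoGroup.comul z))) = copair (mulMap f g) h (CoGroup.comul z)
    generalize (CoGroup.comul z : wedge Z Z) = p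
    rcases p.2 with hp | hp
    · rw [copair_right (mulMap f g) h hp]
      have e : (CoGroup.comul p.1.1 : wedge Z Z) = (wedge Z Z).pt := by
        rw [hp, PMap.map_pt]
      rw [copair_right]
      · exact copair_right g h (congrArg (fun q : wedge Z Z => q.1.2) e)
      · exact congrArg (fun q : wedge Z Z => q.1.1) e
    · rw [copair_left (mulMap f g) h hp]
      show _ = copair f g (CoGroup.comul p.1.1)
      rcases (CoGroup.comul p.1.1 : wedge Z Z).2 with hq | hq
      · rw [copair_right _ _ hq, copair_right f _ (by exact hq)]
        exact copair_left g h hp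
      · rw [copair_left _ _ hq]
        exact copair_left f _ (Subtype.ext (Prod.ext hq hp))
  have e2 : (copair f (copair g h)).comp ((wedgeMap (PMap.id Z) CoGroup.comul).comp
      CoGroup.comul) = mulMap f (mulMap g h) := by
    refine PMap.ext_fun fun z => ?_
    rfl
  rw [e1, e2] at key
  exact key

theorem const_mulMap (f : PMap Z X) : (mulMap (PMap.const Z X) f).Homotopic f := by
  have key := (PMap.Homotopic.refl f).comp (CoGroup.counit_left (Z := Z))
  have e : f.comp ((wedgeSnd Z Z).comp CoGroup.comul) = mulMap (PMap.const Z X) f :=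
    PMap.ext_fun fun z => (copair_const_left f _).symm
  rw [e] at key
  exact key

theorem mulMap_const (f : PMap Z X) : (mulMap f (PMap.const Z X)).Homotopic f := by
  have key := (PMap.Homotopic.refl f).comp (CoGroup.counit_right (Z := Z))
  have e : f.comp ((wedgeFst Z Z).comp CoGroup.comul) = mulMap f (PMap.const Z X) :=
    PMap.ext_fun fun z => (copair_const_right f _).symm
  rw [e] at key
  exact key

theorem comp_fold (f : PMap Z X) (a b : PMap Z Z) :
    f.comp ((fold Z).comp ((wedgeMap a b).comp CoGroup.comul)) =
      mulMap (f.comp a) (f.comp b) := by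
  refine PMap.ext_fun fun z => ?_
  show f (foldFun Z (wedgeMap a b (CoGroup.comul z))) =
    copair (f.comp a) (f.comp b) (CoGroup.comul z)
  generalize (CoGroup.comul z : wedge Z Z) = p
  rcases p.2 with hp | hp
  · rw [copair_right _ _ hp, foldFun_fst]
    · rfl
    · show a p.1.1 = _
      rw [hp, a.map_pt]
  · rw [copair_left _ _ hp, foldFun_snd]
    · rfl
    · show b p.1.2 = _
      rw [hp, b.map_pt]

theorem inv_mulMap (f : PMap Z X) :
    (mulMap (f.comp CoGroup.coinv) f).Homotopic (PMap.const Z X) := by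
  have key := (PMap.Homotopic.refl f).comp (CoGroup.coinv_left (Z := Z))
  rw [comp_fold, const_comp] at key
  exact key

/-- The group structure on `[Z, X]` induced by the co-multiplication and the co-inverse of `Z`. -/
noncomputable instance : Group (HClass Z X) where
  mul := Quotient.map₂ mulMap fun _ _ h _ _ k => mulMap_homotopic h k
  one := Quotient.mk _ (PMap.const Z X)
  inv := HClass.pull CoGroup.coinv
  mul_assoc := by
    rintro ⟨f⟩ ⟨g⟩ ⟨h⟩
    exact Quotient.sound (mulMap_assoc f g h)
  one_mul := by
    rintro ⟨f⟩
    exact Quotient.sound (const_mulMap f)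
  mul_one := by
    rintro ⟨f⟩
    exact Quotient.sound (mulMap_const f)
  inv_mul_cancel := by
    rintro ⟨f⟩
    exact Quotient.sound (inv_mulMap f)

end Group

/-! ## Products and smash products of compactly generated spaces -/

section KProd

/-- The product in compactly generated spaces: the set `X × Y` with the compactly generated
topology associated with the product topology. -/
def KProd (X Y : Type u) : Type u := X × Y

/-- The point `(x, y)` of the product. -/
def KProd.mk {X Y : Type u} (x : X) (y : Y) : KProd X Y := (x, y)

instance (X Y : Type u) [TopologicalSpace X] [TopologicalSpace Y] :
    TopologicalSpace (KProd X Y) :=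
  TopologicalSpace.compactlyGenerated.{u} (X × Y)

variable {X Y : Type u} [TopologicalSpace X] [TopologicalSpace Y]

theorem KProd.continuous_dom {T : Type v} [TopologicalSpace T] {f : KProd X Y → T}
    (h : ∀ (S : Type u) [TopologicalSpace S] [CompactSpace S] [T2Space S] (a : S → X)
      (b : S → Y), Continuous a → Continuous b → Continuous fun s => f (KProd.mk (a s) (b s))) :
    Continuous f :=
  continuous_from_compactlyGenerated.{u} (X := X × Y) f fun S g =>
    h S (fun s => (g s).1) (fun s => (g s).2) (by fun_prop) (by fun_prop)

theorem KProd.continuous_test {S : Type u} [TopologicalSpace S] [CompactSpace S] [T2Space S]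
    {a : S → X} {b : S → Y} (ha : Continuous a) (hb : Continuous b) :
    Continuous fun s => KProd.mk (a s) (b s) := by
  refine continuous_def.2 fun U hU => ?_
  exact (isOpen_sigma_iff.1 (isOpen_coinduced.1 hU))
    ⟨CompHaus.of S, ⟨fun s => (a s, b s), ha.prodMk hb⟩⟩

theorem KProd.continuous_fst : Continuous (fun p : KProd X Y => p.1) :=
  KProd.continuous_dom fun _ _ _ _ _ _ ha _ => ha

theorem KProd.continuous_snd : Continuous (fun p : KProd X Y => p.2) :=
  KProd.continuous_dom fun _ _ _ _ _ _ _ hb => hb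

instance : UCompactlyGeneratedSpace.{u} (KProd X Y) :=
  uCompactlyGeneratedSpace_of_continuous_maps.{u} fun _ h =>
    KProd.continuous_dom fun S _ _ _ _ _ ha hb =>
      h (CompHaus.of S) ⟨_, KProd.continuous_test ha hb⟩

theorem KProd.continuous_mk {T : Type v} [TopologicalSpace T] [UCompactlyGeneratedSpace.{u} T]
    {a : T → X} {b : T → Y} (ha : Continuous a) (hb : Continuous b) :
    Continuous fun t => KProd.mk (a t) (b t) :=
  continuous_from_uCompactlyGeneratedSpace.{u} _ fun S g =>
    KProd.continuous_test (S := S) (ha.comp g.continuous) (hb.comp g.continuous)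

end KProd

section Smash

variable {A B C A' B' : PTop.{u}}

/-- The product of pointed spaces. -/
def prod (A B : PTop.{u}) : PTop.{u} := ⟨KProd A B, KProd.mk A.pt B.pt⟩

/-- The relation on `A × B` that identifies all points of `A ∨ B`. -/
def smashSetoid (A B : PTop.{u}) : Setoid (KProd A B) where
  r p q := p = q ∨ ((p.1 = A.pt ∨ p.2 = B.pt) ∧ (q.1 = A.pt ∨ q.2 = B.pt))
  iseqv := by
    refine ⟨fun _ => Or.inl rfl, ?_, ?_⟩
    · rintro p q (h | h)
      · exact Or.inl h.symm
      · exact Or.inr h.symm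
    · rintro p q r (rfl | h) (rfl | k)
      · exact Or.inl rfl
      · exact Or.inr k
      · exact Or.inr h
      · exact Or.inr ⟨h.1, k.2⟩

/-- The smash product `A ∧ B = (A × B) / (A ∨ B)`. -/
def smash (A B : PTop.{u}) : PTop.{u} :=
  ⟨Quotient (smashSetoid A B), Quotient.mk _ (KProd.mk A.pt B.pt)⟩

/-- The projection `A × B → A ∧ B`. -/
def smashMk (A B : PTop.{u}) : PMap (prod A B) (smash A B) :=
  ⟨⟨Quotient.mk (smashSetoid A B), continuous_quotient_mk'⟩, rfl⟩

instance : UCompactlyGeneratedSpace.{u} (smash A B) :=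
  inferInstanceAs (UCompactlyGeneratedSpace.{u} (Quotient (smashSetoid A B)))

instance : UCompactlyGeneratedSpace.{u} (prod A B) :=
  inferInstanceAs (UCompactlyGeneratedSpace.{u} (KProd A B))

theorem smashMk_eq_pt {p : prod A B} (h : p.1 = A.pt ∨ p.2 = B.pt) :
    smashMk A B p = (smash A B).pt :=
  Quotient.sound (s := smashSetoid A B) (Or.inr ⟨h, Or.inl rfl⟩)

/-- A pointed map on `A × B` that sends `A ∨ B` to the base point induces one on `A ∧ B`. -/
def smashLift {Z : PTop.{v}} (f : PMap (prod A B) Z)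
    (h : ∀ p : prod A B, p.1 = A.pt ∨ p.2 = B.pt → f p = Z.pt) : PMap (smash A B) Z :=
  ⟨⟨Quotient.lift f (by
      rintro p q (rfl | ⟨h1, h2⟩)
      · rfl
      · rw [h p h1, h q h2]), f.cont.quotient_lift _⟩, f.map_pt⟩

/-- The projection `A × B → A`. -/
def prodFst (A B : PTop.{u}) : PMap (prod A B) A := ⟨⟨fun p => p.1, KProd.continuous_fst⟩, rfl⟩

/-- The projection `A × B → B`. -/
def prodSnd (A B : PTop.{u}) : PMap (prod A B) B := ⟨⟨fun p => p.2, KProd.continuous_snd⟩, rfl⟩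

/-- The map `T → A × B` with given components. -/
def prodLift {T : PTop.{v}} [UCompactlyGeneratedSpace.{u} T] (f : PMap T A) (g : PMap T B) :
    PMap T (prod A B) :=
  ⟨⟨fun t => KProd.mk (f t) (g t), KProd.continuous_mk f.cont g.cont⟩, Prod.ext f.map_pt g.map_pt⟩

/-- `f × g`. -/
def prodMap (f : PMap A A') (g : PMap B B') : PMap (prod A B) (prod A' B') :=
  prodLift (f.comp (prodFst A B)) (g.comp (prodSnd A B))

/-- `f ∧ g`. -/
def smashMap (f : PMap A A') (g : PMap B B') : PMap (smash A B) (smash A' B') :=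
  smashLift ((smashMk A' B').comp (prodMap f g)) fun p h =>
    smashMk_eq_pt (h.imp (fun h => by
      show f p.1 = _
      rw [h, f.map_pt]) (fun h => by
      show g p.2 = _
      rw [h, g.map_pt]))

theorem smashMap_homotopic {f f' : PMap A A'} (hf : f.Homotopic f') (g : PMap B B') :
    (smashMap f g).Homotopic (smashMap f' g) := by
  obtain ⟨H, hH, h0, h1, hp⟩ := PMap.homotopic_iff.1 hf
  let F : KProd A B → C(I, smash A' B') := fun p =>
    ⟨fun t => smashMk A' B' (KProd.mk (H (t, p.1)) (g p.2)), (smashMk A' B').cont.comp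
      ((KProd.continuous_test (S := ULift.{u} I) (a := fun t => H (t.down, p.1))
        (b := fun _ => g p.2) (hH.comp (continuous_uliftDown.prodMk continuous_const))
        continuous_const).comp continuous_uliftUp)⟩
  have hF : Continuous F := by
    refine KProd.continuous_dom fun S _ _ _ a b ha hb => ?_
    refine ContinuousMap.continuous_of_continuous_uncurry _ ?_
    exact (smashMk A' B').cont.comp (KProd.continuous_test (S := S × I)
      (a := fun q => H (q.2, a q.1)) (b := fun q => g (b q.1))
      (hH.comp (continuous_snd.prodMk (ha.comp continuous_fst)))
      (g.cont.comp (hb.comp continuous_fst)))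
  have hF0 : ∀ p : KProd A B, (p.1 = A.pt ∨ p.2 = B.pt) →
      F p = ContinuousMap.const I (smash A' B').pt := by
    intro p h
    refine ContinuousMap.ext fun t => smashMk_eq_pt (h.imp (fun h => ?_) (fun h => ?_))
    · show H (t, p.1) = _
      rw [h, hp]
    · show g p.2 = _
      rw [h, g.map_pt]
  let G : smash A B → C(I, smash A' B') := Quotient.lift F (by
    rintro p q (rfl | ⟨k1, k2⟩)
    · rfl
    · rw [hF0 p k1, hF0 q k2])
  have hG : Continuous G := hF.quotient_lift _
  refine PMap.homotopic_iff.2 ⟨fun p => G p.2 p.1, ?_, ?_, ?_, ?_⟩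
  · exact (ContinuousMap.continuous_uncurry_of_continuous ⟨G, hG⟩).comp continuous_swap
  · rintro ⟨p⟩
    show smashMk A' B' (KProd.mk (H (0, p.1)) (g p.2)) = smashMk A' B' (KProd.mk (f p.1) (g p.2))
    rw [h0]
  · rintro ⟨p⟩
    show smashMk A' B' (KProd.mk (H (1, p.1)) (g p.2)) = smashMk A' B' (KProd.mk (f' p.1) (g p.2))
    rw [h1]
  · intro t
    exact congrArg (fun φ : C(I, smash A' B') => φ t) (hF0 (KProd.mk A.pt B.pt) (Or.inl rfl))

/-- The distributivity map `(A ∨ A') ∧ B → (A ∧ B) ∨ (A' ∧ B)`. -/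
def smashDistrib (A A' B : PTop.{u}) :
    PMap (smash (wedge A A') B) (wedge (smash A B) (smash A' B)) :=
  ⟨⟨fun s => ⟨(smashMap (wedgeFst A A') (PMap.id B) s, smashMap (wedgeSnd A A') (PMap.id B) s), by
      induction s using Quotient.inductionOn with
      | h p =>
        exact p.1.2.imp (fun h => smashMk_eq_pt (Or.inl h)) (fun h => smashMk_eq_pt (Or.inl h))⟩,
    Continuous.subtype_mk ((smashMap (wedgeFst A A') (PMap.id B)).cont.prodMk
      (smashMap (wedgeSnd A A') (PMap.id B)).cont) _⟩, rfl⟩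

theorem smashMap_id_comp {D : PTop.{u}} (f : PMap A A') (f' : PMap A' D) :
    smashMap (f'.comp f) (PMap.id B) =
      (smashMap f' (PMap.id B)).comp (smashMap f (PMap.id B)) :=
  PMap.ext_fun (by rintro ⟨p⟩; rfl)

/-- For a co-grouplike space `Γ` and any pointed space `A`, the space `ΓA = Γ ∧ A` is
co-grouplike, with co-multiplication `Γ ∧ A → (Γ ∨ Γ) ∧ A → (Γ ∧ A) ∨ (Γ ∧ A)`. -/
instance instCoGroupSmash (Γ A : PTop.{u}) [CoGroup Γ] : CoGroup (smash Γ A) where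
  comul := (smashDistrib Γ Γ A).comp (smashMap CoGroup.comul (PMap.id A))
  coinv := smashMap CoGroup.coinv (PMap.id A)
  counit_left := by
    have key := smashMap_homotopic (CoGroup.counit_left (Z := Γ)) (PMap.id A)
    convert key using 1 <;> exact PMap.ext_fun (by rintro ⟨p⟩; rfl)
  counit_right := by
    have key := smashMap_homotopic (CoGroup.counit_right (Z := Γ)) (PMap.id A)
    convert key using 1 <;> exact PMap.ext_fun (by rintro ⟨p⟩; rfl)
  coassoc := by
    have key := (PMap.Homotopic.refl ((wedgeMap (PMap.id (smash Γ A)) (smashDistrib Γ Γ A)).comp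
      (smashDistrib Γ (wedge Γ Γ) A))).comp
        (smashMap_homotopic (CoGroup.coassoc (Z := Γ)) (PMap.id A))
    convert key using 1 <;> exact PMap.ext_fun (by rintro ⟨p⟩; rfl)
  coinv_left := by
    have key := smashMap_homotopic (CoGroup.coinv_left (Z := Γ)) (PMap.id A)
    convert key using 1
    · refine PMap.ext_fun ?_
      rintro ⟨p⟩
      show foldFun _ _ = smashMk Γ A (KProd.mk (foldFun Γ _) p.2)
      rcases (CoGroup.comul p.1 : wedge Γ Γ).2 with h | h
      · rw [foldFun_fst, foldFun_fst]
        · rfl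
        · show CoGroup.coinv (CoGroup.comul p.1 : wedge Γ Γ).1.1 = _
          rw [h, PMap.map_pt]
        · refine smashMk_eq_pt (Or.inl ?_)
          show CoGroup.coinv (CoGroup.comul p.1 : wedge Γ Γ).1.1 = _
          rw [h, PMap.map_pt]
      · rw [foldFun_snd, foldFun_snd]
        · rfl
        · exact h
        · exact smashMk_eq_pt (Or.inl h)
    · exact PMap.ext_fun (by rintro ⟨p⟩; exact (smashMk_eq_pt (Or.inl rfl)).symm)
  coinv_right := by
    have key := smashMap_homotopic (CoGroup.coinv_right (Z := Γ)) (PMap.id A)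
    convert key using 1
    · refine PMap.ext_fun ?_
      rintro ⟨p⟩
      show foldFun _ _ = smashMk Γ A (KProd.mk (foldFun Γ _) p.2)
      rcases (CoGroup.comul p.1 : wedge Γ Γ).2 with h | h
      · rw [foldFun_fst, foldFun_fst]
        · rfl
        · exact h
        · exact smashMk_eq_pt (Or.inl h)
      · rw [foldFun_snd, foldFun_snd]
        · rfl
        · show CoGroup.coinv (CoGroup.comul p.1 : wedge Γ Γ).1.2 = _
          rw [h, PMap.map_pt]
        · refine smashMk_eq_pt (Or.inl ?_)
          show CoGroup.coinv (CoGroup.comul p.1 : wedge Γ Γ).1.2 = _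
          rw [h, PMap.map_pt]
    · exact PMap.ext_fun (by rintro ⟨p⟩; exact (smashMk_eq_pt (Or.inl rfl)).symm)

/-- The space `W ⊔ *`, pointed by the added point. -/
def plus (W : Type u) [TopologicalSpace W] : PTop.{u} := ⟨W ⊕ PUnit.{u + 1}, Sum.inr PUnit.unit⟩

/-- The pointed map `W ⊔ * → Z` that extends a continuous map `W → Z`. -/
def plusLift {W : Type u} [TopologicalSpace W] {Z : PTop.{v}} (f : C(W, Z)) : PMap (plus W) Z :=
  ⟨⟨Sum.elim f fun _ => Z.pt, f.continuous.sumElim continuous_const⟩, rfl⟩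

/-- The map `V ⊔ * → W ⊔ *` induced by a continuous map `V → W`. -/
def plusMap {V W : Type u} [TopologicalSpace V] [TopologicalSpace W] (f : C(V, W)) :
    PMap (plus V) (plus W) :=
  plusLift (Z := plus W) ⟨fun v => Sum.inl (f v), continuous_inl.comp f.continuous⟩

/-- The two-point sphere `S⁰`. -/
def S0 : PTop.{u} := plus PUnit.{u + 1}

/-- The pointed space is (homeomorphic to) `S⁰`, so that `ΓW` is `Γ`. -/
def IsS0 (W : PTop.{u}) : Prop := ∃ e : S0.{u} ≃ₜ W, e S0.pt = W.pt

/-! ### Three factors -/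

/-- The projection `(A × B) × C → (A ∧ B) ∧ C`. -/
def smash3Mk (A B C : PTop.{u}) : PMap (prod (prod A B) C) (smash (smash A B) C) :=
  (smashMk (smash A B) C).comp (prodMap (smashMk A B) (PMap.id C))

/-- A pointed map on `(A × B) × C` that sends all points with a coordinate at the base point to
the base point induces a map on `(A ∧ B) ∧ C`. -/
def smash3Lift {Z : PTop.{v}} (f : PMap (prod (prod A B) C) Z)
    (h : ∀ (a : A) (b : B) (c : C), a = A.pt ∨ b = B.pt ∨ c = C.pt →
      f (KProd.mk (KProd.mk a b) c) = Z.pt) :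
    PMap (smash (smash A B) C) Z :=
  smashLift ⟨⟨fun p => Quotient.lift (s := smashSetoid A B) (fun q => f (KProd.mk q p.2)) (by
      rintro p q (rfl | ⟨h1, h2⟩)
      · rfl
      · show f (KProd.mk (KProd.mk p.1 p.2) _) = f (KProd.mk (KProd.mk q.1 q.2) _)
        rw [h _ _ _ (by tauto), h _ _ _ (by tauto)]) p.1, by
      refine KProd.continuous_dom fun S _ _ _ a c ha hc => ?_
      let F : KProd A B → C(S, Z) := fun q =>
        ⟨fun s => f (KProd.mk q (c s)), f.cont.comp (KProd.continuous_test continuous_const hc)⟩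
      have hF : Continuous F := by
        refine KProd.continuous_dom fun T _ _ _ x y hx hy => ?_
        refine ContinuousMap.continuous_of_continuous_uncurry _ ?_
        exact f.cont.comp (KProd.continuous_test (S := T × S)
          (a := fun q => KProd.mk (x q.1) (y q.1)) (b := fun q => c q.2)
          ((KProd.continuous_test hx hy).comp continuous_fst) (hc.comp continuous_snd))
      let G : smash A B → C(S, Z) := Quotient.lift F (by
        rintro p q (rfl | ⟨h1, h2⟩)
        · rfl
        · refine ContinuousMap.ext fun s => ?_
          show f (KProd.mk (KProd.mk p.1 p.2) _) = f (KProd.mk (KProd.mk q.1 q.2) _)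
          rw [h _ _ _ (by tauto), h _ _ _ (by tauto)])
      have hG : Continuous G := hF.quotient_lift _
      have key := (ContinuousMap.continuous_uncurry_of_continuous ⟨G, hG⟩).comp
        (ha.prodMk continuous_id)
      convert key using 1
      funext s
      show Quotient.lift _ _ (a s) = G (a s) s
      induction a s using Quotient.inductionOn with
      | h p => rfl⟩, f.map_pt⟩ (by
      rintro ⟨s, c⟩ hs
      induction s using Quotient.inductionOn with
      | h p =>
        show f (KProd.mk (KProd.mk p.1 p.2) c) = Z.pt
        rcases hs with hs | hs
        · have : (smashSetoid A B).r p (KProd.mk A.pt B.pt) := Quotient.exact hs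
          rcases this with rfl | ⟨h1, -⟩
          · exact h _ _ _ (Or.inl rfl)
          · exact h _ _ _ (by tauto)
        · exact h _ _ _ (Or.inr (Or.inr hs)))

/-- The three coordinates on `(A × B) × C`. -/
def pr1 (A B C : PTop.{u}) : PMap (prod (prod A B) C) A := (prodFst A B).comp (prodFst _ C)
/-- The three coordinates on `(A × B) × C`. -/
def pr2 (A B C : PTop.{u}) : PMap (prod (prod A B) C) B := (prodSnd A B).comp (prodFst _ C)
/-- The three coordinates on `(A × B) × C`. -/
def pr3 (A B C : PTop.{u}) : PMap (prod (prod A B) C) C := prodSnd _ C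

/-- `((a, b), c) ↦ ((b, a), c)`. -/
def t213 (A B C : PTop.{u}) : PMap (prod (prod A B) C) (prod (prod B A) C) :=
  prodLift (prodLift (pr2 A B C) (pr1 A B C)) (pr3 A B C)

/-- `((a, b), c) ↦ ((c, b), a)`. -/
def t321 (A B C : PTop.{u}) : PMap (prod (prod A B) C) (prod (prod C B) A) :=
  prodLift (prodLift (pr3 A B C) (pr2 A B C)) (pr1 A B C)

/-- `((a, b), c) ↦ ((a, c), b)`. -/
def t132 (A B C : PTop.{u}) : PMap (prod (prod A B) C) (prod (prod A C) B) :=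
  prodLift (prodLift (pr1 A B C) (pr3 A B C)) (pr2 A B C)

/-- `((a, b), c) ↦ ((c, a), b)`. -/
def t312 (A B C : PTop.{u}) : PMap (prod (prod A B) C) (prod (prod C A) B) :=
  prodLift (prodLift (pr3 A B C) (pr1 A B C)) (pr2 A B C)

/-- `((a, b), c) ↦ ((b, c), a)`. -/
def t231 (A B C : PTop.{u}) : PMap (prod (prod A B) C) (prod (prod B C) A) :=
  prodLift (prodLift (pr2 A B C) (pr3 A B C)) (pr1 A B C)

theorem smash3Mk_eq_pt {a : A} {b : B} {c : C} (h : a = A.pt ∨ b = B.pt ∨ c = C.pt) :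
    smash3Mk A B C (KProd.mk (KProd.mk a b) c) = (smash (smash A B) C).pt := by
  refine smashMk_eq_pt ?_
  rcases h with h | h | h
  · exact Or.inl (smashMk_eq_pt (Or.inl h))
  · exact Or.inl (smashMk_eq_pt (Or.inr h))
  · exact Or.inr h

/-- `(a ∧ b) ∧ c ↦ (b ∧ a) ∧ c`. -/
def s213 (A B C : PTop.{u}) : PMap (smash (smash A B) C) (smash (smash B A) C) :=
  smash3Lift ((smash3Mk B A C).comp (t213 A B C)) fun _ _ _ h => smash3Mk_eq_pt (by tauto)

/-- `(a ∧ b) ∧ c ↦ (c ∧ b) ∧ a`. -/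
def s321 (A B C : PTop.{u}) : PMap (smash (smash A B) C) (smash (smash C B) A) :=
  smash3Lift ((smash3Mk C B A).comp (t321 A B C)) fun _ _ _ h => smash3Mk_eq_pt (by tauto)

/-- `(a ∧ b) ∧ c ↦ (a ∧ c) ∧ b`. -/
def s132 (A B C : PTop.{u}) : PMap (smash (smash A B) C) (smash (smash A C) B) :=
  smash3Lift ((smash3Mk A C B).comp (t132 A B C)) fun _ _ _ h => smash3Mk_eq_pt (by tauto)

/-- `(a ∧ b) ∧ c ↦ (c ∧ a) ∧ b`. -/
def s312 (A B C : PTop.{u}) : PMap (smash (smash A B) C) (smash (smash C A) B) :=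
  smash3Lift ((smash3Mk C A B).comp (t312 A B C)) fun _ _ _ h => smash3Mk_eq_pt (by tauto)

/-- `(a ∧ b) ∧ c ↦ (b ∧ c) ∧ a`. -/
def s231 (A B C : PTop.{u}) : PMap (smash (smash A B) C) (smash (smash B C) A) :=
  smash3Lift ((smash3Mk B C A).comp (t231 A B C)) fun _ _ _ h => smash3Mk_eq_pt (by tauto)

end Smash

/-! ## The `Γ`-Fox groups and the `Γ`-Whitehead product -/

section Fox

open scoped commutatorElement

variable (Γ : PTop.{u})

/-- The map `(Γf)^* : [ΓB, X] → [ΓA, X]` induced by `f : A → B`. -/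
def gpull {A B : PTop.{u}} {X : PTop.{v}} (f : PMap A B) :
    HClass (smash Γ B) X → HClass (smash Γ A) X :=
  HClass.pull (smashMap (PMap.id Γ) f)

/-- The `Γ`-Fox group `τ^Γ_W(X) = [Γ(W ⊔ *), X]`. -/
abbrev FoxGroup (W : Type u) [TopologicalSpace W] (X : PTop.{v}) : Type (max u v) :=
  HClass (smash Γ (plus W)) X

/-- The map `[ΓZ, X] → τ^Γ_W(X)` induced by a continuous map `W → Z`, through `W ⊔ * → Z`. -/
def toFox {W : Type u} [TopologicalSpace W] {Z : PTop.{u}} {X : PTop.{v}} (f : C(W, Z)) :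
    HClass (smash Γ Z) X → FoxGroup Γ W X :=
  gpull Γ (plusLift f)

variable {Γ} [CoGroup Γ]

/-- `κ ∈ [Γ(A ∧ B), X]` is the class of a map `K' : Γ(A ∧ B) → X` induced by the commutator
`K = f' · g' · f'⁻¹ · g'⁻¹ : Γ(A × B) → X`, where `f'` and `g'` are the composites of
representatives of `α` and `β` with the projections of `Γ(A × B)` to `ΓA` and `ΓB`. -/
def IsGammaWhitehead {A B : PTop.{u}} {X : PTop.{v}} (α : HClass (smash Γ A) X)
    (β : HClass (smash Γ B) X) (κ : HClass (smash Γ (smash A B)) X) : Prop :=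
  gpull Γ (smashMk A B) κ = ⁅gpull Γ (prodFst A B) α, gpull Γ (prodSnd A B) β⁆

open Classical in
/-- The `Γ`-Whitehead product `[α, β]_Γ ∈ [Γ(A ∧ B), X]` (`1` if there is no such class). -/
noncomputable def gammaWhitehead {A B : PTop.{u}} {X : PTop.{v}} (α : HClass (smash Γ A) X)
    (β : HClass (smash Γ B) X) : HClass (smash Γ (smash A B)) X :=
  if h : ∃ κ, IsGammaWhitehead α β κ then h.choose else 1

/-- The map `(A × B) ⊔ * → (A ⊔ *) ∧ (B ⊔ *)`. -/
def plusProd (A B : PTop.{u}) : PMap (plus (prod A B)) (smash (plus A) (plus B)) :=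
  plusLift ⟨fun p => smashMk (plus A) (plus B) (KProd.mk (Sum.inl p.1) (Sum.inl p.2)),
    (smashMk (plus A) (plus B)).cont.comp (KProd.continuous_mk
      (continuous_inl.comp (prodFst A B).cont) (continuous_inl.comp (prodSnd A B).cont))⟩

/-- The `Γ`-Whitehead product `τ^Γ_A(X) × τ^Γ_B(X) → τ^Γ_{A × B}(X)`, through the identification
of `(A ⊔ *) ∧ (B ⊔ *)` with `(A × B) ⊔ *`. -/
noncomputable def foxWhitehead {A B : PTop.{u}} {X : PTop.{v}} (a : FoxGroup Γ A X)
    (b : FoxGroup Γ B X) : FoxGroup Γ (prod A B) X :=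
  gpull Γ (plusProd A B) (gammaWhitehead a b)

/-- `ζ = η^ξ` for `ξ ∈ [Γ, X] = [ΓS⁰, X]` and `η ∈ [ΓW, X]`: in the group `τ^Γ_W(X)`, which contains
`[ΓW, X]` through `W ⊔ * → W` and `[Γ, X]` through `W ⊔ * → S⁰`, one has `ζ = ξ η ξ⁻¹`. -/
def IsConjAct {W : PTop.{u}} {X : PTop.{v}} (ξ : HClass (smash Γ S0) X)
    (η ζ : HClass (smash Γ W) X) : Prop :=
  toFox Γ (ContinuousMap.id W) ζ =
    gpull Γ (plusMap (ContinuousMap.const W PUnit.unit)) ξ * toFox Γ (ContinuousMap.id W) η *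
      (gpull Γ (plusMap (ContinuousMap.const W PUnit.unit)) ξ)⁻¹

open Classical in
/-- The action `η^ξ` of `ξ ∈ [Γ, X] = [ΓS⁰, X]` on `η ∈ [ΓW, X]` (`η` if there is no such
class). -/
noncomputable def conjAct {W : PTop.{u}} {X : PTop.{v}} (ξ : HClass (smash Γ S0) X)
    (η : HClass (smash Γ W) X) : HClass (smash Γ W) X :=
  if h : ∃ ζ, IsConjAct ξ η ζ then h.choose else η

open Classical in
/-- `ξ · η` for `ξ ∈ [ΓV, X]`: it is `η^ξ` if `V` is `S⁰`, so that `ξ ∈ [Γ, X]`, and `η`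
otherwise. -/
noncomputable def dotAct {V W : PTop.{u}} {X : PTop.{v}} (ξ : HClass (smash Γ V) X)
    (η : HClass (smash Γ W) X) : HClass (smash Γ W) X :=
  if h : IsS0 V then
    conjAct (gpull Γ ⟨⟨h.choose, h.choose.continuous⟩, h.choose_spec⟩ ξ) η
  else η

end Fox

end GammaFox

open GammaFox

namespace GammaFox

open TopologicalSpace unitInterval Topology

open scoped commutatorElement

/-! The collapse `A × B × C → A ∧ B ∧ C` induces an injection of `[Γ(A ∧ B ∧ C), X]` into
`[Γ(A × B × C), X]`. Indeed, for `P × Q → P ∧ Q` the Puppe sequence reduces this to the extension of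
classes on `Γ(P ∨ Q)`, with values in the loop space of `X`, to `Γ(P × Q)`; since these classes are
pairs of classes on `ΓP` and `ΓQ`, the product of their images under the projections is such an
extension. The injection turns `Γ`-Whitehead products into commutators, and the three identities
become the Hall–Witt identity in the group `[Γ(A × B × C), X]`.

Co-commutativity enters as follows. With `M = A × B × C`, a map of `M` that is trivial over the base
point of `B` induces on `Γ` a map that factors through the co-homomorphism `ΓM → ΓB ∧ (M ⊔ *)`.
If `ΓB` is co-commutative, so is the target, and the classes that such maps induce commute. This
applies to `β` and to every iterated commutator in which `β` occurs: the conjugations in the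
Hall–Witt identity disappear, and `⁅β⁻¹, α⁆` becomes `⁅α, β⁆`. -/

/-! ### Continuity out of compactly generated products -/

theorem continuous_prod_of_tests {K : Type w} [TopologicalSpace K] [LocallyCompactSpace K]
    {W : Type u} [TopologicalSpace W] [UCompactlyGeneratedSpace.{u} W] {T : Type v}
    [TopologicalSpace T] {f : K × W → T}
    (hf : ∀ (S : Type u) [TopologicalSpace S] [CompactSpace S] [T2Space S] (g : S → W),
      Continuous g → Continuous fun p : K × S => f (p.1, g p.2)) : Continuous f := by
  let F : W → C(K, T) := fun x => ⟨fun t => f (t, x),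
    (hf PUnit (fun _ => x) continuous_const).comp (g := fun p : K × PUnit => f (p.1, x))
      (f := fun t => (t, PUnit.unit)) (continuous_id.prodMk continuous_const)⟩
  have hF : Continuous F := continuous_from_uCompactlyGeneratedSpace.{u} F fun S g =>
    ContinuousMap.continuous_of_continuous_uncurry _ ((hf S g g.continuous).comp continuous_swap)
  exact (ContinuousMap.continuous_uncurry_of_continuous ⟨F, hF⟩).comp continuous_swap

theorem continuous_prod_kprod_of_tests {K : Type w} [TopologicalSpace K] [LocallyCompactSpace K]
    {X Y : Type u} [TopologicalSpace X] [TopologicalSpace Y] {T : Type v} [TopologicalSpace T]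
    {f : K × KProd X Y → T}
    (hf : ∀ (S : Type u) [TopologicalSpace S] [CompactSpace S] [T2Space S] (a : S → X) (b : S → Y),
      Continuous a → Continuous b →
        Continuous fun p : K × S => f (p.1, KProd.mk (a p.2) (b p.2))) : Continuous f :=
  continuous_prod_of_tests fun S _ _ _ g hg =>
    hf S (fun s => (g s).1) (fun s => (g s).2) (KProd.continuous_fst.comp hg)
      (KProd.continuous_snd.comp hg)

theorem isQuotientMap_smashMk (A B : PTop.{u}) : IsQuotientMap (smashMk A B) :=
  isQuotientMap_quotient_mk'

theorem continuous_prod_smash_of_tests {K : Type w} [TopologicalSpace K] [LocallyCompactSpace K]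
    {A B : PTop.{u}} {T : Type v} [TopologicalSpace T] {f : K × smash A B → T}
    (hf : ∀ (S : Type u) [TopologicalSpace S] [CompactSpace S] [T2Space S] (a : S → A) (b : S → B),
      Continuous a → Continuous b →
        Continuous fun p : K × S => f (p.1, smashMk A B (KProd.mk (a p.2) (b p.2)))) :
    Continuous f :=
  (isQuotientMap_smashMk A B).continuous_lift_prod_right (continuous_prod_kprod_of_tests hf)

theorem continuous_of_isClosed_cover {X : Type u} {T : Type v} [TopologicalSpace X]
    [TopologicalSpace T] {s t : Set X} {f : X → T} (hs : IsClosed s) (ht : IsClosed t)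
    (hst : ∀ x, x ∈ s ∨ x ∈ t) (hfs : Continuous fun x : s => f x)
    (hft : Continuous fun x : t => f x) : Continuous f := by
  rw [← continuousOn_univ, ← (Set.eq_univ_of_forall hst : s ∪ t = Set.univ)]
  exact (continuousOn_iff_continuous_domRestrict.2 hfs).union_of_isClosed
    (continuousOn_iff_continuous_domRestrict.2 hft) hs ht

/- For a test map `(a, c) : S → D × C`, the function `z ↦ f (a ·, z)` into `C(S, T)` is continuous
because its composite with `q` is. -/
theorem continuous_of_comp_prodMap_id {D A C : PTop.{u}} [UCompactlyGeneratedSpace.{u} A]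
    {q : PMap A C} (hq : IsQuotientMap q) {T : Type v} [TopologicalSpace T] {f : prod D C → T}
    (hf : Continuous fun p : prod D A => f (prodMap (PMap.id D) q p)) : Continuous f := by
  refine KProd.continuous_dom fun S _ _ _ a c ha hc => ?_
  let F : A → C(S, T) := fun x => ⟨fun s => f (KProd.mk (a s) (q x)),
    hf.comp (KProd.continuous_test ha (continuous_const (y := x)))⟩
  have hF : Continuous F := continuous_from_uCompactlyGeneratedSpace.{u} F fun R g =>
    ContinuousMap.continuous_of_continuous_uncurry _ (hf.comp
      (KProd.continuous_test (S := R × S) (ha.comp continuous_snd)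
        (g.continuous.comp continuous_fst)))
  have hFq : Function.FactorsThrough F q := fun x y hxy =>
    ContinuousMap.ext fun s => congrArg (fun z => f (KProd.mk (a s) z)) hxy
  let G : C(C, C(S, T)) := hq.lift (f := q.toMap) ⟨F, hF⟩ hFq
  have hG : ∀ z s, G z s = f (KProd.mk (a s) z) := fun z s => by
    obtain ⟨x, rfl⟩ := hq.surjective z
    exact DFunLike.congr_fun (DFunLike.congr_fun (hq.lift_comp ⟨F, hF⟩ hFq) x) s
  exact ((ContinuousMap.continuous_uncurry_of_continuous G).comp (hc.prodMk continuous_id)).congr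
    fun s => hG (c s) s

theorem isQuotientMap_prodMap_id (D : PTop.{u}) {A C : PTop.{u}} [UCompactlyGeneratedSpace.{u} A]
    {q : PMap A C} (hq : IsQuotientMap q) : IsQuotientMap (prodMap (PMap.id D) q) := by
  refine ⟨isCoinducing_iff.2 fun U => ⟨fun hU => ?_, fun hU => hU.preimage (PMap.cont _)⟩,
    fun p => ?_⟩
  · exact isOpen_iff_continuous_mem.2
      (continuous_of_comp_prodMap_id hq (isOpen_iff_continuous_mem.1 hU))
  · obtain ⟨a, ha⟩ := hq.surjective p.2
    exact ⟨KProd.mk p.1 a, Prod.ext rfl ha⟩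

theorem isQuotientMap_smashMap_id (D : PTop.{u}) {A C : PTop.{u}} [UCompactlyGeneratedSpace.{u} A]
    {q : PMap A C} (hq : IsQuotientMap q) : IsQuotientMap (smashMap (PMap.id D) q) :=
  IsQuotientMap.of_comp (smashMk D A).cont (smashMap (PMap.id D) q).cont
    ((isQuotientMap_smashMk D C).comp (isQuotientMap_prodMap_id D hq))

/-! ### Functoriality -/

section Functoriality

variable {A B C D Γ : PTop.{u}} {X Y : PTop.{v}}

theorem smashMk_eq_iff {p q : prod A B} :
    smashMk A B p = smashMk A B q ↔
      p = q ∨ ((p.1 = A.pt ∨ p.2 = B.pt) ∧ (q.1 = A.pt ∨ q.2 = B.pt)) :=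
  ⟨fun h => Quotient.exact (s := smashSetoid A B) h,
    fun h => Quotient.sound (s := smashSetoid A B) h⟩

theorem smashMk_eq_pt_iff {p : prod A B} :
    smashMk A B p = (smash A B).pt ↔ p.1 = A.pt ∨ p.2 = B.pt := by
  refine ⟨fun h => ?_, smashMk_eq_pt⟩
  rcases smashMk_eq_iff.1 (h : smashMk A B p = smashMk A B (KProd.mk A.pt B.pt)) with rfl | h
  · exact Or.inl rfl
  · exact h.1

theorem smash_ext {f g : PMap (smash A B) X}
    (h : ∀ (a : A) (b : B), f (smashMk A B (KProd.mk a b)) = g (smashMk A B (KProd.mk a b))) :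
    f = g :=
  PMap.ext_fun (by rintro ⟨p⟩; exact h p.1 p.2)

/-- The class of a map. -/
def PMap.cls (f : PMap A X) : HClass A X := Quotient.mk _ f

theorem PMap.cls_eq_iff {f g : PMap A X} : f.cls = g.cls ↔ f.Homotopic g := Quotient.eq

theorem PMap.cls_eq_one_iff [CoGroup A] {f : PMap A X} :
    f.cls = 1 ↔ f.Homotopic (PMap.const A X) := PMap.cls_eq_iff

theorem HClass.exists_cls_eq (κ : HClass A X) : ∃ f : PMap A X, f.cls = κ := Quotient.exists_rep κ

theorem HClass.pull_comp (f : PMap A B) (g : PMap B C) (κ : HClass C X) :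
    HClass.pull f (HClass.pull g κ) = HClass.pull (g.comp f) κ := by
  obtain ⟨k, rfl⟩ := κ.exists_cls_eq
  rfl

theorem HClass.pull_congr {f g : PMap A B} (h : f.Homotopic g) (κ : HClass B X) :
    HClass.pull f κ = HClass.pull g κ := by
  obtain ⟨k, rfl⟩ := κ.exists_cls_eq
  exact PMap.cls_eq_iff.2 ((PMap.Homotopic.refl k).comp h)

theorem HClass.pull_id (κ : HClass A X) : HClass.pull (PMap.id A) κ = κ := by
  obtain ⟨k, rfl⟩ := κ.exists_cls_eq
  rfl

theorem comp_copair (e : PMap X Y) (f : PMap A X) (g : PMap B X) :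
    e.comp (copair f g) = copair (e.comp f) (e.comp g) := by
  refine PMap.ext_fun fun p => ?_
  rcases p.2 with hp | hp
  · rw [copair_right _ _ hp]
    exact congrArg e (copair_right _ _ hp)
  · rw [copair_left _ _ hp]
    exact congrArg e (copair_left _ _ hp)

theorem comp_mulMap [CoGroup A] (e : PMap X Y) (f g : PMap A X) :
    e.comp (mulMap f g) = mulMap (e.comp f) (e.comp g) :=
  congrArg (fun k : PMap (wedge A A) Y => k.comp CoGroup.comul) (comp_copair e f g)

/-- A map that commutes with the co-multiplications. -/
def IsCoHom [CoGroup A] [CoGroup B] (φ : PMap A B) : Prop :=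
  (CoGroup.comul (Z := B)).comp φ = (wedgeMap φ φ).comp CoGroup.comul

theorem IsCoHom.mulMap_comp [CoGroup A] [CoGroup B] {φ : PMap A B} (h : IsCoHom φ)
    (f g : PMap B X) : (mulMap f g).comp φ = mulMap (f.comp φ) (g.comp φ) :=
  congrArg (fun k : PMap A (wedge B B) => (copair f g).comp k) h

theorem IsCoHom.pull_mul [CoGroup A] [CoGroup B] {φ : PMap A B} (h : IsCoHom φ)
    (κ ν : HClass B X) : HClass.pull φ (κ * ν) = HClass.pull φ κ * HClass.pull φ ν := by
  obtain ⟨f, rfl⟩ := κ.exists_cls_eq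
  obtain ⟨g, rfl⟩ := ν.exists_cls_eq
  exact congrArg PMap.cls (h.mulMap_comp f g)

theorem isCoHom_smashMap [CoGroup Γ] (f : PMap A B) : IsCoHom (smashMap (PMap.id Γ) f) :=
  smash_ext fun _ _ => rfl

/-- The map `(Γf)^*` as a group homomorphism. -/
noncomputable def gpullHom (Γ : PTop.{u}) [CoGroup Γ] (f : PMap A B) :
    HClass (smash Γ B) X →* HClass (smash Γ A) X :=
  MonoidHom.mk' (gpull Γ f) fun κ ν => (isCoHom_smashMap f).pull_mul κ ν

theorem gpull_mul [CoGroup Γ] (f : PMap A B) (κ ν : HClass (smash Γ B) X) :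
    gpull Γ f (κ * ν) = gpull Γ f κ * gpull Γ f ν := map_mul (gpullHom Γ f) κ ν

theorem gpull_one [CoGroup Γ] (f : PMap A B) :
    gpull Γ f (1 : HClass (smash Γ B) X) = 1 := map_one (gpullHom Γ f)

theorem gpull_inv [CoGroup Γ] (f : PMap A B) (κ : HClass (smash Γ B) X) :
    gpull Γ f κ⁻¹ = (gpull Γ f κ)⁻¹ := map_inv (gpullHom Γ f) κ

theorem gpull_commutator [CoGroup Γ] (f : PMap A B) (κ ν : HClass (smash Γ B) X) :
    gpull Γ f ⁅κ, ν⁆ = ⁅gpull Γ f κ, gpull Γ f ν⁆ := map_commutatorElement (gpullHom Γ f) κ ν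

theorem gpull_gpull (f : PMap A B) (g : PMap B C) (κ : HClass (smash Γ C) X) :
    gpull Γ f (gpull Γ g κ) = gpull Γ (g.comp f) κ := by
  rw [gpull, gpull, HClass.pull_comp]
  exact congrArg (fun k => HClass.pull k κ) (smash_ext fun _ _ => rfl)

theorem gpull_id (κ : HClass (smash Γ A) X) : gpull Γ (PMap.id A) κ = κ := by
  rw [gpull, show smashMap (PMap.id Γ) (PMap.id A) = PMap.id _ from smash_ext fun _ _ => rfl,
    HClass.pull_id]

theorem gpull_const [CoGroup Γ] (κ : HClass (smash Γ B) X) :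
    gpull Γ (PMap.const A B) κ = 1 := by
  obtain ⟨k, rfl⟩ := κ.exists_cls_eq
  refine congrArg PMap.cls (smash_ext fun a b => ?_)
  exact (congrArg k (smashMk_eq_pt (p := KProd.mk a B.pt) (Or.inr rfl))).trans k.map_pt

/-- The interchange of the two factors. -/
def smashSwap (A B : PTop.{u}) : PMap (smash A B) (smash B A) :=
  smashLift ((smashMk B A).comp (prodLift (prodSnd A B) (prodFst A B))) fun _ h =>
    smashMk_eq_pt h.symm

theorem smashMap_homotopic_right (f : PMap A B) {g g' : PMap C D} (hg : g.Homotopic g') :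
    (smashMap f g).Homotopic (smashMap f g') := by
  have h_swapped := ((PMap.Homotopic.refl (smashSwap D B)).comp (smashMap_homotopic hg f)).comp
    (PMap.Homotopic.refl (smashSwap A C))
  convert h_swapped using 1 <;> exact smash_ext fun _ _ => rfl

theorem gpull_congr {f g : PMap A B} (h : f.Homotopic g) (κ : HClass (smash Γ B) X) :
    gpull Γ f κ = gpull Γ g κ :=
  HClass.pull_congr (smashMap_homotopic_right _ h) κ

theorem gpull_gpull_of_homotopic_id {f : PMap A B} {g : PMap B A}
    (h : (g.comp f).Homotopic (PMap.id A)) (κ : HClass (smash Γ A) X) :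
    gpull Γ f (gpull Γ g κ) = κ := by
  rw [gpull_gpull, gpull_congr h, gpull_id]

end Functoriality

/-! ### Fibres and deformation retracts -/

section Fiber

variable {A C : PTop.{u}} {X Y : PTop.{v}} {T : PTop.{w}}

/-- The fibre of a pointed map over the base point, as a subspace of the source. -/
def fiber (q : PMap X Y) : PTop.{v} := ⟨{x : X // q x = Y.pt}, ⟨X.pt, q.map_pt⟩⟩

/-- The inclusion of the fibre. -/
def fiberIncl (q : PMap X Y) : PMap (fiber q) X := ⟨⟨Subtype.val, continuous_subtype_val⟩, rfl⟩

/-- The map into the fibre of `q` given by a map `f` with `q ∘ f` constant. -/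
def fiberLift (q : PMap X Y) (f : PMap T X) (h : ∀ x, q (f x) = Y.pt) : PMap T (fiber q) :=
  ⟨⟨fun x => ⟨f x, h x⟩, Continuous.subtype_mk f.cont _⟩, Subtype.ext f.map_pt⟩

/-- The map `ΓB → ΓA`, for the fibre `B` of `q : A → C`. -/
def smashFiberIncl (Γ : PTop.{u}) (q : PMap A C) : PMap (smash Γ (fiber q)) (smash Γ A) :=
  smashMap (PMap.id Γ) (fiberIncl q)

theorem smashMap_smashFiberIncl (Γ : PTop.{u}) (q : PMap A C) (x : smash Γ (fiber q)) :
    smashMap (PMap.id Γ) q (smashFiberIncl Γ q x) = (smash Γ C).pt := by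
  obtain ⟨p, rfl⟩ := (isQuotientMap_smashMk Γ (fiber q)).surjective x
  exact smashMk_eq_pt (Or.inr p.2.2)

end Fiber

/-- A deformation that exhibits `B` as a neighbourhood deformation retract of `A` in the sense of
Strøm. Each point `p` has arrived in `B` from time `w p` on; if `1 < w p`, it need not arrive. -/
structure NDR {A : Type u} [TopologicalSpace A] (B : Set A) where
  /-- the time of arrival in `B` -/
  w : A → ℝ
  /-- the deformation -/
  h : I × A → A
  continuous_w : Continuous w
  continuous_h : Continuous h
  w_nonneg : ∀ p, 0 ≤ w p
  w_eq_zero : ∀ p ∈ B, w p = 0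
  h_zero : ∀ p, h (0, p) = p
  h_mem : ∀ p ∈ B, ∀ t, h (t, p) = p
  h_arrived : ∀ p (t : I), w p ≤ t → h (t, p) ∈ B

/-- The point of the unit interval closest to a real number. -/
noncomputable def clamp (r : ℝ) : I := Set.projIcc 0 1 zero_le_one r

theorem continuous_clamp : Continuous clamp := continuous_projIcc (h := zero_le_one)

theorem clamp_coe (t : I) : clamp t = t := Set.projIcc_val _ t

theorem clamp_of_nonpos {r : ℝ} (h : r ≤ 0) : clamp r = 0 := Set.projIcc_of_le_left _ h

theorem le_clamp {r s : ℝ} (hrs : r ≤ s) (hr : r ≤ 1) : r ≤ clamp s := by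
  rw [clamp, Set.coe_projIcc]
  exact le_max_of_le_right (le_min hr hrs)

theorem min_clamp_of_nonpos {r : ℝ} (h : r ≤ 0) (t : I) : min t (clamp r) = 0 := by
  rw [clamp_of_nonpos h]
  exact min_eq_right t.2.1

theorem le_min_clamp {r s : ℝ} {t : I} (hrs : r ≤ s) (hrt : r ≤ t) : r ≤ min t (clamp s) := by
  rw [Monotone.map_min (f := ((↑) : I → ℝ)) fun _ _ h => h]
  exact le_min hrt (le_clamp hrs (hrt.trans t.2.2))

namespace NDR

variable {A : Type u} [TopologicalSpace A] {B : Set A} (N : NDR B)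

/-- The endpoint of the deformation of a point, if it arrives in `B`. -/
noncomputable def retract (p : A) : A := N.h (clamp (N.w p), p)

theorem continuous_retract : Continuous N.retract :=
  N.continuous_h.comp ((continuous_clamp.comp N.continuous_w).prodMk continuous_id)

theorem retract_of_mem {p : A} (hp : p ∈ B) : N.retract p = p := N.h_mem p hp _

theorem retract_mem {p : A} {t : I} (h : N.w p ≤ t) : N.retract p ∈ B :=
  N.h_arrived p _ (le_clamp le_rfl (h.trans t.2.2))

end NDR

/-! ### Homotopy extension -/

section HomotopyExtension

variable {Γ A C : PTop.{u}} {Y : PTop.{v}} {q : PMap A C} (N : NDR {p : A | q p = C.pt})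
  (f : PMap (smash Γ A) Y) (G : I × smash Γ (fiber q) → Y)

open Classical in
/-- The extension of a homotopy `G` on `ΓB` that starts at the restriction of `f`: a point of `A`
first follows the deformation to `B`, and then `G` is applied for the remaining time. -/
noncomputable def NDR.extend (x : I × prod Γ A) : Y :=
  if ht : N.w x.2.2 ≤ x.1 then
    G (clamp (x.1 - N.w x.2.2),
      smashMk Γ (fiber q) (KProd.mk x.2.1 ⟨N.retract x.2.2, N.retract_mem ht⟩))
  else f (smashMk Γ A (KProd.mk x.2.1 (N.h (x.1, x.2.2))))

variable {N f G}

theorem NDR.extend_of_le {x : I × prod Γ A} (ht : N.w x.2.2 ≤ x.1) :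
    N.extend f G x = G (clamp (x.1 - N.w x.2.2),
      smashMk Γ (fiber q) (KProd.mk x.2.1 ⟨N.retract x.2.2, N.retract_mem ht⟩)) :=
  dif_pos ht

theorem NDR.extend_of_ge (hG : ∀ x, G (0, x) = f (smashFiberIncl Γ q x)) {x : I × prod Γ A}
    (ht : x.1 ≤ N.w x.2.2) :
    N.extend f G x = f (smashMk Γ A (KProd.mk x.2.1 (N.h (x.1, x.2.2)))) := by
  by_cases ht' : N.w x.2.2 ≤ x.1
  · have hw : N.w x.2.2 = x.1 := le_antisymm ht' ht
    rw [extend_of_le ht', hw, sub_self, clamp_of_nonpos le_rfl, hG]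
    change f (smashMk Γ A (KProd.mk x.2.1 (N.h (clamp (N.w x.2.2), x.2.2)))) = _
    rw [hw, clamp_coe]
  · exact dif_neg ht'

theorem NDR.extend_eq_pt (hG : ∀ t, G (t, (smash Γ (fiber q)).pt) = Y.pt) (t : I) {p : prod Γ A}
    (hp : p.1 = Γ.pt ∨ p.2 = A.pt) : N.extend f G (t, p) = Y.pt := by
  have h_pt : ∀ s, p.2 = A.pt → N.h (s, p.2) = A.pt := fun s h => by
    rw [h]
    exact N.h_mem _ q.map_pt s
  by_cases ht : N.w p.2 ≤ t
  · have h_collapse : smashMk Γ (fiber q) (KProd.mk p.1 ⟨N.retract p.2, N.retract_mem ht⟩) =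
        (smash Γ (fiber q)).pt := smashMk_eq_pt (hp.imp id fun h => Subtype.ext (h_pt _ h))
    exact (extend_of_le (x := (t, p)) ht).trans
      ((congrArg (fun z => G (_, z)) h_collapse).trans (hG _))
  · have h_collapse : smashMk Γ A (KProd.mk p.1 (N.h (t, p.2))) = (smash Γ A).pt :=
      smashMk_eq_pt (hp.imp id (h_pt _))
    exact (dif_neg ht).trans ((congrArg f h_collapse).trans f.map_pt)

theorem NDR.extend_fiber (t : I) (p : prod Γ (fiber q)) :
    N.extend f G (t, KProd.mk p.1 p.2.1) = G (t, smashMk Γ (fiber q) p) := by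
  have hw : N.w p.2.1 = 0 := N.w_eq_zero _ p.2.2
  have hr : N.retract p.2.1 = p.2.1 := N.retract_of_mem p.2.2
  refine (extend_of_le (x := (t, KProd.mk p.1 p.2.1)) (hw.le.trans t.2.1)).trans ?_
  congr 2
  · exact (congrArg (fun r => clamp (t - r)) hw).trans (by rw [sub_zero, clamp_coe])
  · exact congrArg _ (Prod.ext rfl (Subtype.ext hr))

theorem NDR.continuous_extend (hG : Continuous G) (hG0 : ∀ x, G (0, x) = f (smashFiberIncl Γ q x))
    {S : Type u} [TopologicalSpace S] [CompactSpace S] [T2Space S] {a : S → Γ} {b : S → A}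
    (ha : Continuous a) (hb : Continuous b) :
    Continuous fun p : I × S => N.extend f G (p.1, KProd.mk (a p.2) (b p.2)) := by
  have hw : Continuous fun p : I × S => N.w (b p.2) :=
    N.continuous_w.comp (hb.comp continuous_snd)
  have ht : Continuous fun p : I × S => (p.1 : ℝ) := by fun_prop
  have hle : IsClosed {p : I × S | N.w (b p.2) ≤ p.1} := isClosed_le hw ht
  refine continuous_of_isClosed_cover hle (isClosed_le ht hw)
    (fun p => le_total (N.w (b p.2)) p.1) ?_ ?_
  · have : CompactSpace {p : I × S | N.w (b p.2) ≤ p.1} :=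
      isCompact_iff_compactSpace.1 hle.isCompact
    refine Continuous.congr (hG.comp (Continuous.prodMk ?_ ?_)) fun p =>
      (extend_of_le (x := (p.1.1, KProd.mk (a p.1.2) (b p.1.2))) p.2).symm
    · exact continuous_clamp.comp ((ht.sub hw).comp continuous_subtype_val)
    · exact (smashMk Γ (fiber q)).cont.comp (KProd.continuous_test (by fun_prop)
        (Continuous.subtype_mk (N.continuous_retract.comp (by fun_prop)) _))
  · have h_deform : Continuous fun p : I × S => KProd.mk (a p.2) (N.h (p.1, b p.2)) :=
      KProd.continuous_test (ha.comp continuous_snd)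
        (N.continuous_h.comp (continuous_fst.prodMk (hb.comp continuous_snd)))
    exact (f.cont.comp ((smashMk Γ A).cont.comp (h_deform.comp continuous_subtype_val))).congr
      fun p => (extend_of_ge hG0 (x := (p.1.1, KProd.mk (a p.1.2) (b p.1.2))) p.2).symm

theorem NDR.homotopy_extension (N : NDR {p : A | q p = C.pt}) (hG : Continuous G)
    (hG0 : ∀ x, G (0, x) = f (smashFiberIncl Γ q x))
    (hGp : ∀ t, G (t, (smash Γ (fiber q)).pt) = Y.pt) :
    ∃ F : I × smash Γ A → Y, Continuous F ∧ (∀ x, F (0, x) = f x) ∧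
      (∀ t x, F (t, smashFiberIncl Γ q x) = G (t, x)) ∧ ∀ t, F (t, (smash Γ A).pt) = Y.pt := by
  let F : I × smash Γ A → Y := fun x => Quotient.lift (s := smashSetoid Γ A)
    (fun p => N.extend f G (x.1, p)) (by
      rintro p p' (rfl | ⟨hp, hp'⟩)
      · rfl
      · exact (NDR.extend_eq_pt hGp _ hp).trans (NDR.extend_eq_pt hGp _ hp').symm) x.2
  refine ⟨F, ?_, ?_, ?_, fun t => NDR.extend_eq_pt hGp t (Or.inl rfl)⟩
  · exact continuous_prod_smash_of_tests fun S _ _ _ a b ha hb =>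
      NDR.continuous_extend hG hG0 ha hb
  · rintro ⟨p⟩
    refine (NDR.extend_of_ge hG0 (x := (0, p)) (N.w_nonneg _)).trans ?_
    rw [N.h_zero]
    rfl
  · rintro t ⟨p⟩
    exact NDR.extend_fiber t p

end HomotopyExtension

/-! ### Collapsing maps and exactness -/

/-- The quotient map `q` collapses its fibre over the base point, and nothing else. -/
structure Collapse {A C : PTop.{u}} (q : PMap A C) : Prop where
  isQuotientMap : IsQuotientMap q
  eq_or : ∀ p p', q p = q p' → p = p' ∨ q p = C.pt

namespace Collapse

variable {Γ A C : PTop.{u}} {X Y Z : PTop.{v}} {q : PMap A C}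

theorem factorsThrough (hq : Collapse q) {T : Type v} {f : smash Γ A → T} {y : T}
    (hf : ∀ x, f (smashFiberIncl Γ q x) = y) :
    Function.FactorsThrough f (smashMap (PMap.id Γ) q) := by
  intro x x' h
  have const_on : ∀ p : prod Γ A, p.1 = Γ.pt ∨ q p.2 = C.pt → f (smashMk Γ A p) = y := by
    rintro p (hp | hp)
    · rw [smashMk_eq_pt (Or.inl hp), ← hf (smash Γ (fiber q)).pt, PMap.map_pt]
    · exact hf (smashMk Γ (fiber q) (KProd.mk p.1 ⟨p.2, hp⟩))
  obtain ⟨p, rfl⟩ := (isQuotientMap_smashMk Γ A).surjective x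
  obtain ⟨p', rfl⟩ := (isQuotientMap_smashMk Γ A).surjective x'
  rcases smashMk_eq_iff.1 (h : smashMk Γ C (KProd.mk p.1 (q p.2)) =
    smashMk Γ C (KProd.mk p'.1 (q p'.2))) with h | ⟨hp, hp'⟩
  · obtain ⟨h₁, h₂⟩ := Prod.mk.inj h
    rcases hq.eq_or _ _ h₂ with h' | h'
    · rw [show p = p' from Prod.ext h₁ h']
    · rw [const_on p (Or.inr h'), const_on p' (Or.inr (h₂.symm.trans h'))]
  · rw [const_on p hp, const_on p' hp']

variable [UCompactlyGeneratedSpace.{u} A]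

theorem exists_comp_eq (hq : Collapse q) {f : PMap (smash Γ A) Y}
    (hf : ∀ x, f (smashFiberIncl Γ q x) = Y.pt) :
    ∃ f' : PMap (smash Γ C) Y, f'.comp (smashMap (PMap.id Γ) q) = f := by
  have hΓq := isQuotientMap_smashMap_id Γ hq.isQuotientMap
  have comp_eq := hΓq.lift_comp (f := (smashMap (PMap.id Γ) q).toMap) f.toMap
    (hq.factorsThrough hf)
  refine ⟨⟨_, ?_⟩, PMap.ext comp_eq⟩
  rw [← (smashMap (PMap.id Γ) q).map_pt]
  exact (DFunLike.congr_fun comp_eq _).trans f.map_pt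

theorem homotopic_of_comp (hq : Collapse q) {f g : PMap (smash Γ C) Y} {H : I × smash Γ A → Y}
    (hH : Continuous H) (hH0 : ∀ x, H (0, x) = f (smashMap (PMap.id Γ) q x))
    (hH1 : ∀ x, H (1, x) = g (smashMap (PMap.id Γ) q x))
    (hHB : ∀ t x, H (t, smashFiberIncl Γ q x) = Y.pt) : f.Homotopic g := by
  have hΓq := isQuotientMap_smashMap_id Γ hq.isQuotientMap
  choose s hs using hΓq.surjective
  have hHs : ∀ t x, H (t, s (smashMap (PMap.id Γ) q x)) = H (t, x) := fun t x =>
    hq.factorsThrough (f := fun x => H (t, x)) (hHB t) (hs _)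
  refine PMap.homotopic_iff.2 ⟨fun z => H (z.1, s z.2), ?_, fun z => ?_, fun z => ?_, fun t => ?_⟩
  · exact hΓq.continuous_lift_prod_right (hH.congr fun z => (hHs z.1 z.2).symm)
  · exact (hH0 _).trans (congrArg f (hs z))
  · exact (hH1 _).trans (congrArg g (hs z))
  · have hp := hHs t (smashFiberIncl Γ q (smash Γ (fiber q)).pt)
    rwa [smashMap_smashFiberIncl, hHB] at hp

/- The homotopy of `f` that extends the null-homotopy of `l` ends at a map that descends to `ΓC`;
it lies over a homotopy that is constant on `ΓB` and therefore descends as well. -/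
theorem exact (hq : Collapse q) (N : NDR {p : A | q p = C.pt}) {f : PMap (smash Γ A) Y}
    {e : PMap Y Z} {g : PMap (smash Γ C) Z} (hfg : e.comp f = g.comp (smashMap (PMap.id Γ) q))
    {l : PMap (smash Γ (fiber q)) (fiber e)}
    (hl : (fiberIncl e).comp l = f.comp (smashFiberIncl Γ q))
    (hl_null : l.Homotopic (PMap.const _ _)) :
    ∃ f' : PMap (smash Γ C) Y, f.Homotopic (f'.comp (smashMap (PMap.id Γ) q)) ∧
      g.Homotopic (e.comp f') := by
  obtain ⟨G, hG, hG0, hG1, hGp⟩ := PMap.homotopic_iff.1 hl_null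
  obtain ⟨F, hF, hF0, hFG, hFp⟩ := N.homotopy_extension (f := f) (G := fun x => fiberIncl e (G x))
    ((fiberIncl e).cont.comp hG)
    (fun x => (congrArg _ (hG0 x)).trans (DFunLike.congr_fun (congrArg PMap.toMap hl) x))
    (fun t => (congrArg _ (hGp t)).trans (fiberIncl e).map_pt)
  let F₁ : PMap (smash Γ A) Y :=
    ⟨⟨fun x => F (1, x), hF.comp (continuous_const.prodMk continuous_id)⟩, hFp 1⟩
  obtain ⟨f', hf'⟩ := hq.exists_comp_eq (f := F₁) fun x =>
    (hFG 1 x).trans ((congrArg _ (hG1 x)).trans (fiberIncl e).map_pt)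
  have hff' : f.Homotopic (f'.comp (smashMap (PMap.id Γ) q)) := by
    rw [hf']
    exact PMap.homotopic_iff.2 ⟨F, hF, hF0, fun _ => rfl, hFp⟩
  refine ⟨f', hff', hq.homotopic_of_comp (H := fun x => e (F x)) (e.cont.comp hF)
    (fun x => ?_) (fun x => ?_) fun t x => ?_⟩
  · exact (congrArg e (hF0 x)).trans (DFunLike.congr_fun (congrArg PMap.toMap hfg) x)
  · exact congrArg e (DFunLike.congr_fun (congrArg PMap.toMap hf') x).symm
  · exact (congrArg e (hFG t x)).trans (G (t, x)).2

theorem exists_gpull_eq [CoGroup Γ] (hq : Collapse q) (N : NDR {p : A | q p = C.pt})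
    {κ : HClass (smash Γ A) X} (hκ : gpull Γ (fiberIncl q) κ = 1) : ∃ κ', gpull Γ q κ' = κ := by
  obtain ⟨f, rfl⟩ := κ.exists_cls_eq
  let j : PMap X (fiber (PMap.const X X)) := fiberLift _ (PMap.id X) fun _ => rfl
  obtain ⟨f', hf', -⟩ := hq.exact N (f := f) (e := PMap.const X X) (g := PMap.const _ X) rfl
    (l := j.comp (f.comp (smashFiberIncl Γ q))) rfl
    ((PMap.Homotopic.refl j).comp (PMap.cls_eq_one_iff.1 hκ))
  exact ⟨f'.cls, (PMap.cls_eq_iff.2 hf').symm⟩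

end Collapse

section PathSpace

variable {A : PTop.{u}} {X : PTop.{v}}

/-- The space of paths that end at the base point. -/
def pathSpace (X : PTop.{v}) : PTop.{v} :=
  ⟨{p : C(I, X) // p 1 = X.pt}, ⟨ContinuousMap.const I X.pt, rfl⟩⟩

/-- The evaluation of a path at its start. -/
def pathEval (X : PTop.{v}) : PMap (pathSpace X) X :=
  ⟨⟨fun p => p.1 0, (continuous_eval_const 0).comp continuous_subtype_val⟩, rfl⟩

/-- The loop space. -/
abbrev loopSpace (X : PTop.{v}) : PTop.{v} := fiber (pathEval X)

theorem pathEval_homotopic_const (X : PTop.{v}) :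
    (pathEval X).Homotopic (PMap.const _ X) :=
  PMap.homotopic_iff.2 ⟨fun p => p.2.1 p.1,
    (continuous_subtype_val.comp continuous_snd).eval continuous_fst, fun _ => rfl, fun p => p.2,
    fun _ => rfl⟩

theorem PMap.homotopic_const_iff_exists_lift {f : PMap A X} :
    f.Homotopic (PMap.const A X) ↔ ∃ n : PMap A (pathSpace X), (pathEval X).comp n = f := by
  constructor
  · intro h
    obtain ⟨H, hH, hH0, hH1, hHp⟩ := PMap.homotopic_iff.1 h
    exact ⟨⟨⟨fun x => ⟨⟨fun t => H (t, x), by fun_prop⟩, hH1 x⟩,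
      Continuous.subtype_mk (ContinuousMap.curry
        ⟨fun p : A × I => H (p.2, p.1), hH.comp continuous_swap⟩).continuous _⟩,
      Subtype.ext (ContinuousMap.ext hHp)⟩, PMap.ext_fun hH0⟩
  · rintro ⟨n, rfl⟩
    exact (pathEval_homotopic_const X).comp (PMap.Homotopic.refl n)

end PathSpace

/- A null-homotopy of `f ∘ Γq` restricts to a map `l` of `ΓB` to the loop space. Once it is changed
by an extension of `l⁻¹` to `ΓA`, its restriction to `ΓB` is trivial, and it descends to `ΓC`. -/
theorem Collapse.gpull_injective {Γ A C : PTop.{u}} {X : PTop.{v}} {q : PMap A C}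
    [UCompactlyGeneratedSpace.{u} A] [CoGroup Γ] (hq : Collapse q) (N : NDR {p : A | q p = C.pt})
    (hs : Function.Surjective
      (gpull Γ (fiberIncl q) : HClass (smash Γ A) (loopSpace X) → _)) :
    Function.Injective (gpull Γ q : HClass (smash Γ C) X → _) := by
  refine (injective_iff_map_eq_one (gpullHom Γ q)).2 fun κ hκ => ?_
  obtain ⟨f, rfl⟩ := κ.exists_cls_eq
  obtain ⟨n, hn⟩ := PMap.homotopic_const_iff_exists_lift.1 (PMap.cls_eq_one_iff.1 hκ)
  have hn_apply : ∀ x, pathEval X (n x) = f (smashMap (PMap.id Γ) q x) := fun x =>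
    DFunLike.congr_fun (congrArg PMap.toMap hn) x
  let l : PMap (smash Γ (fiber q)) (loopSpace X) :=
    fiberLift (pathEval X) (n.comp (smashFiberIncl Γ q)) fun x =>
      (hn_apply _).trans ((congrArg f (smashMap_smashFiberIncl Γ q x)).trans f.map_pt)
  obtain ⟨μ, hμ⟩ := hs l.cls⁻¹
  obtain ⟨m, rfl⟩ := μ.exists_cls_eq
  have h_eval : (pathEval X).comp (mulMap n ((fiberIncl (pathEval X)).comp m)) =
      (mulMap f (PMap.const _ X)).comp (smashMap (PMap.id Γ) q) := by
    rw [comp_mulMap, (isCoHom_smashMap q).mulMap_comp, hn]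
    exact congrArg (mulMap _) (PMap.ext_fun fun x => (m x).2)
  have h_fiber : (fiberIncl (pathEval X)).comp (mulMap l (m.comp (smashFiberIncl Γ q))) =
      (mulMap n ((fiberIncl (pathEval X)).comp m)).comp (smashFiberIncl Γ q) := by
    rw [comp_mulMap]
    exact ((isCoHom_smashMap (Γ := Γ) (fiberIncl q)).mulMap_comp n
      ((fiberIncl (pathEval X)).comp m)).symm
  have h_null : (mulMap l (m.comp (smashFiberIncl Γ q))).cls = 1 := by
    change l.cls * gpull Γ (fiberIncl q) m.cls = 1
    rw [hμ, mul_inv_cancel]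
  obtain ⟨f', -, hf'⟩ := hq.exact N h_eval h_fiber (PMap.cls_eq_one_iff.1 h_null)
  calc f.cls = f.cls * 1 := (mul_one _).symm
    _ = ((pathEval X).comp f').cls := PMap.cls_eq_iff.2 hf'
    _ = 1 := PMap.cls_eq_one_iff.2 (PMap.homotopic_const_iff_exists_lift.2 ⟨f', rfl⟩)

/-! ### Well-pointed spaces -/

section NDR

variable {A C P Q W : PTop.{u}}

theorem mem_of_forall_pos_mem {s : Set I} (hs : IsClosed s) (h : ∀ t, 0 < t → t ∈ s) (t : I) :
    t ∈ s := by
  have h_dense : Dense (Set.Ioi (0 : I)) := by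
    rw [dense_iff_closure_eq, closure_Ioi' ⟨1, zero_lt_one⟩]
    exact Set.eq_univ_of_forall fun s => s.2.1
  exact closure_minimal h hs (h_dense t)

/- If `r` is the retraction of the cylinder, then `p` has certainly arrived at the time `t` when
`t` exceeds the maximum over `s` of the distance of `r (p, s)` from the height `s`. -/
theorem WellPointed.nonempty_ndr (h : WellPointed P) : Nonempty (NDR ({P.pt} : Set P)) := by
  obtain ⟨h_closed, r, hr, hr_id⟩ := h
  let d : C(P, C(I, ℝ)) := ContinuousMap.curry
    ⟨fun p : P × I => (p.2 : ℝ) - (r p).2, by fun_prop⟩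
  have arrived_of_lt : ∀ p (t : I), ‖d p‖ < t → (r (p, t)).1 = P.pt := fun p t ht =>
    (hr (p, t)).resolve_left fun h => by
      have hd : (t : ℝ) - (r (p, t)).2 ≤ ‖d p‖ :=
        (le_abs_self _).trans ((d p).norm_coe_le_norm t)
      rw [h, Set.Icc.coe_zero, sub_zero] at hd
      exact ht.not_ge hd
  refine ⟨⟨fun p => 2 * ‖d p‖, fun x => (r (x.2, x.1)).1, by fun_prop, by fun_prop,
    fun p => by positivity, ?_, fun p => congrArg Prod.fst (hr_id (p, 0) (Or.inl rfl)), ?_,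
    fun p t ht => ?_⟩⟩
  · rintro p (rfl : p = P.pt)
    have h_zero : d P.pt = 0 := ContinuousMap.ext fun t => by
      change (t : ℝ) - (r (P.pt, t)).2 = 0
      rw [hr_id (P.pt, t) (Or.inr rfl), sub_self]
    rw [h_zero, norm_zero, mul_zero]
  · rintro p (rfl : p = P.pt) t
    exact congrArg Prod.fst (hr_id (P.pt, t) (Or.inr rfl))
  · change (r (p, t)).1 = P.pt
    rcases (norm_nonneg (d p)).eq_or_lt with h_norm | h_norm
    · refine mem_of_forall_pos_mem (s := {s | (r (p, s)).1 = P.pt})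
        (h_closed.preimage (f := fun s : I => (r (p, s)).1) (by fun_prop)) (fun s hs => ?_) t
      exact arrived_of_lt p s (h_norm ▸ hs)
    · exact arrived_of_lt p t (by linarith)

theorem NDR.eq_pt_of_w_eq_zero (N : NDR ({P.pt} : Set P)) {p : P} (h : N.w p = 0) : p = P.pt := by
  rw [← N.h_zero p]
  exact N.h_arrived p 0 h.le

theorem NDR.isClosed_pt (N : NDR ({P.pt} : Set P)) : IsClosed ({P.pt} : Set P) := by
  have h_pt : ({P.pt} : Set P) = N.w ⁻¹' {0} :=
    Set.ext fun p => ⟨fun h => N.w_eq_zero p h, fun h => N.eq_pt_of_w_eq_zero h⟩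
  exact h_pt ▸ isClosed_singleton.preimage N.continuous_w

theorem NDR.wellPointed (N : NDR ({P.pt} : Set P)) : WellPointed P := by
  refine ⟨N.isClosed_pt,
    ⟨fun x => (N.h (min x.2 (clamp (N.w x.1)), x.1), clamp (x.2 - N.w x.1)), ?_⟩,
    fun x => ?_, fun x hx => ?_⟩
  · have hw : Continuous fun x : P × I => N.w x.1 := N.continuous_w.comp continuous_fst
    exact (N.continuous_h.comp ((continuous_snd.min (continuous_clamp.comp hw)).prodMk
      continuous_fst)).prodMk (continuous_clamp.comp (Continuous.sub (by fun_prop) hw))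
  · rcases le_total (x.2 : ℝ) (N.w x.1) with h | h
    · exact Or.inl (clamp_of_nonpos (sub_nonpos.2 h))
    · exact Or.inr (N.h_arrived _ _ (le_min_clamp le_rfl h))
  · obtain ⟨p, t⟩ := x
    rcases hx with (rfl : t = 0) | (rfl : p = P.pt)
    · refine Prod.ext ?_ (clamp_of_nonpos (by simpa using N.w_nonneg p))
      exact (congrArg (fun t => N.h (t, p)) (min_eq_left (clamp (N.w p)).2.1)).trans (N.h_zero p)
    · refine Prod.ext (N.h_mem _ rfl _) ?_
      change clamp ((t : ℝ) - N.w P.pt) = t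
      rw [N.w_eq_zero _ rfl, sub_zero, clamp_coe]

theorem NDR.nonempty_of_collapse {q : PMap A C} (N : NDR {p : A | q p = C.pt}) (hq : Collapse q) :
    Nonempty (NDR ({C.pt} : Set C)) := by
  choose s hqs using hq.isQuotientMap.surjective
  have hsq : ∀ p, s (q p) = p ∨ q p = C.pt := fun p =>
    (hq.eq_or (s (q p)) p (hqs (q p))).imp id fun h => (hqs (q p)).symm.trans h
  have hw : ∀ p, N.w (s (q p)) = N.w p := fun p => by
    rcases hsq p with h | h
    · rw [h]
    · rw [N.w_eq_zero p h, N.w_eq_zero _ ((hqs (q p)).trans h)]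
  have hh : ∀ t p, q (N.h (t, s (q p))) = q (N.h (t, p)) := fun t p => by
    rcases hsq p with h | h
    · rw [h]
    · rw [N.h_mem p h, N.h_mem _ ((hqs (q p)).trans h), hqs]
  refine ⟨⟨fun z => N.w (s z), fun x => q (N.h (x.1, s x.2)), ?_, ?_, fun z => N.w_nonneg _, ?_,
    fun z => (congrArg q (N.h_zero (s z))).trans (hqs z), ?_, fun z t ht => N.h_arrived _ _ ht⟩⟩
  · exact hq.isQuotientMap.continuous_iff.2 (N.continuous_w.congr fun p => (hw p).symm)
  · refine hq.isQuotientMap.continuous_lift_prod_right ?_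
    exact (q.cont.comp N.continuous_h).congr fun p => (hh p.1 p.2).symm
  · rintro z (rfl : z = C.pt)
    exact N.w_eq_zero _ (hqs _)
  · rintro z (rfl : z = C.pt) t
    exact (congrArg q (N.h_mem _ (hqs _) t)).trans (hqs _)

theorem Collapse.isOpen_image {q : PMap A C} (hq : Collapse q) {U : Set A} (hU : IsOpen U)
    (hU_pt : ∀ p ∈ U, q p ≠ C.pt) : IsOpen (q '' U) := by
  have h_image : q ⁻¹' (q '' U) ⊆ U := fun p ⟨p', hp', h⟩ =>
    (hq.eq_or p' p h).resolve_right (hU_pt p' hp') ▸ hp'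
  rw [← hq.isQuotientMap.isOpen_preimage]
  rwa [h_image.antisymm (Set.subset_preimage_image q U)]

theorem Collapse.t2Space [T2Space A] {q : PMap A C} (hq : Collapse q)
    (N : NDR ({C.pt} : Set C)) : T2Space C := by
  refine ⟨fun x y hxy => ?_⟩
  by_cases hw : N.w x = N.w y
  · have hx : x ≠ C.pt := fun hx => hxy
      (hx.trans (N.eq_pt_of_w_eq_zero (hw ▸ N.w_eq_zero x hx)).symm)
    have hy : y ≠ C.pt := fun hy => hxy
      ((N.eq_pt_of_w_eq_zero (hw.trans (N.w_eq_zero y hy))).trans hy.symm)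
    obtain ⟨a, rfl⟩ := hq.isQuotientMap.surjective x
    obtain ⟨b, rfl⟩ := hq.isQuotientMap.surjective y
    obtain ⟨U, V, hU, hV, ha, hb, hUV⟩ := t2_separation fun h : a = b => hxy (congrArg q h)
    have hO : IsOpen {p | q p ≠ C.pt} := N.isClosed_pt.isOpen_compl.preimage q.cont
    refine ⟨_, _, hq.isOpen_image (hU.inter hO) fun p hp => hp.2,
      hq.isOpen_image (hV.inter hO) fun p hp => hp.2, ⟨a, ⟨ha, hx⟩, rfl⟩, ⟨b, ⟨hb, hy⟩, rfl⟩, ?_⟩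
    refine Set.disjoint_left.2 ?_
    rintro _ ⟨p, hp, rfl⟩ ⟨p', hp', h⟩
    obtain rfl := (hq.eq_or p' p h).resolve_right hp'.2
    exact Set.disjoint_left.1 hUV hp.1 hp'.1
  · exact separated_by_continuous N.continuous_w hw

/-- The wedge is a neighbourhood deformation retract of the product. Each factor moves until the
other one has arrived. -/
noncomputable def NDR.wedge (M : NDR ({P.pt} : Set P)) (N : NDR ({Q.pt} : Set Q)) :
    NDR {p : prod P Q | smashMk P Q p = (smash P Q).pt} where
  w p := min (M.w p.1) (N.w p.2)
  h x := KProd.mk (M.h (min x.1 (clamp (N.w x.2.2)), x.2.1))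
    (N.h (min x.1 (clamp (M.w x.2.1)), x.2.2))
  continuous_w := (M.continuous_w.comp (prodFst P Q).cont).min
    (N.continuous_w.comp (prodSnd P Q).cont)
  continuous_h := continuous_prod_kprod_of_tests fun S _ _ _ a b ha hb => by
    have ha' : Continuous fun p : I × S => a p.2 := ha.comp continuous_snd
    have hb' : Continuous fun p : I × S => b p.2 := hb.comp continuous_snd
    exact KProd.continuous_test
      (M.continuous_h.comp ((continuous_fst.min
        (continuous_clamp.comp (N.continuous_w.comp hb'))).prodMk ha'))
      (N.continuous_h.comp ((continuous_fst.min
        (continuous_clamp.comp (M.continuous_w.comp ha'))).prodMk hb'))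
  w_nonneg p := le_min (M.w_nonneg _) (N.w_nonneg _)
  w_eq_zero p hp := by
    rcases smashMk_eq_pt_iff.1 hp with h | h
    · rw [M.w_eq_zero _ h, min_eq_left (N.w_nonneg _)]
    · rw [N.w_eq_zero _ h, min_eq_right (M.w_nonneg _)]
  h_zero p := by
    have h0 : ∀ t : I, min 0 t = 0 := fun t => min_eq_left t.2.1
    exact Prod.ext ((congrArg (fun t => M.h (t, p.1)) (h0 _)).trans (M.h_zero _))
      ((congrArg (fun t => N.h (t, p.2)) (h0 _)).trans (N.h_zero _))
  h_mem p hp t := by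
    rcases smashMk_eq_pt_iff.1 hp with h | h
    · exact Prod.ext (M.h_mem _ h _) ((congrArg (fun s => N.h (s, p.2))
        (min_clamp_of_nonpos (M.w_eq_zero _ h).le t)).trans (N.h_zero _))
    · exact Prod.ext ((congrArg (fun s => M.h (s, p.1))
        (min_clamp_of_nonpos (N.w_eq_zero _ h).le t)).trans (M.h_zero _)) (N.h_mem _ h _)
  h_arrived p t ht := by
    refine smashMk_eq_pt_iff.2 ?_
    rcases le_total (M.w p.1) (N.w p.2) with h | h
    · exact Or.inl (M.h_arrived _ _ (le_min_clamp h ((min_eq_left h).ge.trans ht)))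
    · exact Or.inr (N.h_arrived _ _ (le_min_clamp h ((min_eq_right h).ge.trans ht)))

/-- The deformation of a product to its base point. -/
noncomputable def NDR.prod (M : NDR ({P.pt} : Set P)) (N : NDR ({Q.pt} : Set Q)) :
    NDR ({(prod P Q).pt} : Set (prod P Q)) where
  w p := max (M.w p.1) (N.w p.2)
  h x := KProd.mk (M.h (x.1, x.2.1)) (N.h (x.1, x.2.2))
  continuous_w := (M.continuous_w.comp (prodFst P Q).cont).max
    (N.continuous_w.comp (prodSnd P Q).cont)
  continuous_h := continuous_prod_kprod_of_tests fun S _ _ _ a b ha hb =>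
    KProd.continuous_test
      (M.continuous_h.comp (continuous_fst.prodMk (ha.comp continuous_snd)))
      (N.continuous_h.comp (continuous_fst.prodMk (hb.comp continuous_snd)))
  w_nonneg p := le_max_of_le_left (M.w_nonneg _)
  w_eq_zero := by
    rintro _ rfl
    change max (M.w P.pt) (N.w Q.pt) = 0
    rw [M.w_eq_zero _ rfl, N.w_eq_zero _ rfl, max_self]
  h_zero p := Prod.ext (M.h_zero _) (N.h_zero _)
  h_mem := by
    rintro _ rfl t
    exact Prod.ext (M.h_mem _ rfl _) (N.h_mem _ rfl _)
  h_arrived p t ht := Prod.ext (M.h_arrived _ _ ((le_max_left _ _).trans ht))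
    (N.h_arrived _ _ ((le_max_right _ _).trans ht))

/-- The projection `W ⊔ * → W`. -/
def plusId (W : PTop.{u}) : PMap (plus W) W := plusLift (ContinuousMap.id W)

/-- The fibre `S⁰` of `W ⊔ * → W` as a neighbourhood deformation retract. -/
noncomputable def NDR.plusId (M : NDR ({W.pt} : Set W)) : NDR {p | plusId W p = W.pt} where
  w := Sum.elim M.w fun _ => 0
  h x := Sum.elim (fun y : I × W => Sum.inl (M.h y)) (fun y : I × PUnit => Sum.inr y.2)
    (Homeomorph.prodSumDistrib x)
  continuous_w := M.continuous_w.sumElim continuous_const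
  continuous_h := ((continuous_inl.comp M.continuous_h).sumElim
    (continuous_inr.comp continuous_snd)).comp Homeomorph.prodSumDistrib.continuous
  w_nonneg := Sum.rec M.w_nonneg fun _ => le_rfl
  w_eq_zero := Sum.rec M.w_eq_zero fun _ _ => rfl
  h_zero := Sum.rec (fun p => congrArg Sum.inl (M.h_zero p)) fun _ => rfl
  h_mem := Sum.rec (fun p hp t => congrArg Sum.inl (M.h_mem p hp t)) fun _ _ _ => rfl
  h_arrived := Sum.rec (fun p t ht => M.h_arrived p t ht) fun _ _ _ => rfl

theorem wellPointed_plus (V : Type u) [TopologicalSpace V] : WellPointed (plus V) := by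
  refine ⟨?_, ⟨fun x => (x.1, Sum.elim (fun _ => 0) Prod.snd (Homeomorph.sumProdDistrib x)), ?_⟩,
    fun x => ?_, fun x hx => ?_⟩
  · have h_range : Set.range (Sum.inr : PUnit → plus V) = {(plus V).pt} := Set.range_unique
    exact h_range ▸ isClosed_range_inr
  · exact continuous_fst.prodMk ((continuous_const.sumElim continuous_snd).comp
      Homeomorph.sumProdDistrib.continuous)
  · obtain ⟨_ | _, t⟩ := x
    · exact Or.inl rfl
    · exact Or.inr rfl
  · obtain ⟨_ | _, t⟩ := x
    · exact Prod.ext rfl (hx.resolve_right Sum.inl_ne_inr).symm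
    · rfl

theorem collapse_smashMk (P Q : PTop.{u}) : Collapse (smashMk P Q) where
  isQuotientMap := isQuotientMap_smashMk P Q
  eq_or _ _ h := (smashMk_eq_iff.1 h).imp id fun h => smashMk_eq_pt h.1

theorem collapse_plusId (W : PTop.{u}) : Collapse (plusId W) where
  isQuotientMap := IsQuotientMap.of_comp (f := (Sum.inl : W → plus W)) continuous_inl
    (plusId W).cont IsQuotientMap.id
  eq_or := by
    rintro (_ | _) (_ | _) h
    · exact Or.inl (congrArg Sum.inl h)
    · exact Or.inr h
    · exact Or.inr rfl
    · exact Or.inl rfl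

end NDR

/-! ### Homotopy types -/

section HomotopyType

variable {P Q P' Q' : PTop.{u}}

/-- The spaces of the pointed homotopy type of a well-pointed compactly generated space, which need
not be Hausdorff. -/
def HasWellPointedCGType (P : PTop.{u}) : Prop :=
  ∃ Y : PTop.{u}, CompactlyGeneratedSpace Y ∧ WellPointed Y ∧ PHomotopyEquivalent P Y

theorem WellPointed.smash (hP : WellPointed P) (hQ : WellPointed Q) : WellPointed (smash P Q) := by
  obtain ⟨M⟩ := hP.nonempty_ndr
  obtain ⟨N⟩ := hQ.nonempty_ndr
  exact ((M.wedge N).nonempty_of_collapse (collapse_smashMk P Q)).some.wellPointed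

theorem WellPointed.prod (hP : WellPointed P) (hQ : WellPointed Q) : WellPointed (prod P Q) := by
  obtain ⟨M⟩ := hP.nonempty_ndr
  obtain ⟨N⟩ := hQ.nonempty_ndr
  exact (M.prod N).wellPointed

theorem WellPointed.t2Space_smash [T2Space P] [T2Space Q] (hP : WellPointed P)
    (hQ : WellPointed Q) : T2Space (GammaFox.smash P Q) := by
  have : T2Space (GammaFox.prod P Q) :=
    .of_injective_continuous (f := fun p : KProd P Q => (p.1, p.2)) (fun _ _ h => h)
      ((prodFst P Q).cont.prodMk (prodSnd P Q).cont)
  exact (collapse_smashMk P Q).t2Space (hP.smash hQ).nonempty_ndr.some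

instance {V : Type u} [TopologicalSpace V] [UCompactlyGeneratedSpace.{u} V] :
    UCompactlyGeneratedSpace.{u} (plus V) :=
  inferInstanceAs (UCompactlyGeneratedSpace.{u} (V ⊕ PUnit.{u + 1}))

theorem PMap.Homotopic.trans {X : PTop.{u}} {Y : PTop.{v}} {f g h : PMap X Y}
    (hf : f.Homotopic g) (hg : g.Homotopic h) : f.Homotopic h :=
  (PMap.setoid X Y).iseqv.trans hf hg

theorem smashMap_comp_homotopic_id {f : PMap P P'} {g : PMap P' P} {k : PMap Q Q'}
    {l : PMap Q' Q} (hf : (g.comp f).Homotopic (PMap.id P))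
    (hk : (l.comp k).Homotopic (PMap.id Q)) :
    ((smashMap g l).comp (smashMap f k)).Homotopic (PMap.id (smash P Q)) := by
  have h := (smashMap_homotopic hf (l.comp k)).trans (smashMap_homotopic_right (PMap.id P) hk)
  convert h using 1 <;> exact smash_ext fun _ _ => rfl

theorem PHomotopyEquivalent.smash (hP : PHomotopyEquivalent P P')
    (hQ : PHomotopyEquivalent Q Q') : PHomotopyEquivalent (smash P Q) (smash P' Q') := by
  obtain ⟨f, g, hgf, hfg⟩ := hP
  obtain ⟨k, l, hlk, hkl⟩ := hQ
  exact ⟨smashMap f k, smashMap g l, smashMap_comp_homotopic_id hgf hlk,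
    smashMap_comp_homotopic_id hfg hkl⟩

theorem prodMap_homotopic {f f' : PMap P P'} {g g' : PMap Q Q'} (hf : f.Homotopic f')
    (hg : g.Homotopic g') : (prodMap f g).Homotopic (prodMap f' g') := by
  obtain ⟨H, hH, h0, h1, hp⟩ := PMap.homotopic_iff.1 hf
  obtain ⟨K, hK, k0, k1, kp⟩ := PMap.homotopic_iff.1 hg
  refine PMap.homotopic_iff.2 ⟨fun x => KProd.mk (H (x.1, x.2.1)) (K (x.1, x.2.2)), ?_,
    fun x => Prod.ext (h0 _) (k0 _), fun x => Prod.ext (h1 _) (k1 _),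
    fun t => Prod.ext (hp t) (kp t)⟩
  exact continuous_prod_kprod_of_tests fun S _ _ _ a b ha hb => KProd.continuous_test
    (hH.comp (continuous_fst.prodMk (ha.comp continuous_snd)))
    (hK.comp (continuous_fst.prodMk (hb.comp continuous_snd)))

theorem PHomotopyEquivalent.prod (hP : PHomotopyEquivalent P P')
    (hQ : PHomotopyEquivalent Q Q') : PHomotopyEquivalent (prod P Q) (prod P' Q') := by
  obtain ⟨f, g, hgf, hfg⟩ := hP
  obtain ⟨k, l, hlk, hkl⟩ := hQ
  exact ⟨prodMap f k, prodMap g l, prodMap_homotopic hgf hlk, prodMap_homotopic hfg hkl⟩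

theorem plus_ext {V : Type u} [TopologicalSpace V] {X : PTop.{v}} {f g : PMap (plus V) X}
    (h : ∀ x, f (Sum.inl x) = g (Sum.inl x)) : f = g :=
  PMap.ext_fun (by
    rintro (x | _)
    · exact h x
    · exact f.map_pt.trans g.map_pt.symm)

theorem plusMap_homotopic {f f' : PMap P P'} (hf : f.Homotopic f') :
    (plusMap f.toMap).Homotopic (plusMap f'.toMap) := by
  obtain ⟨H, hH, h0, h1, -⟩ := PMap.homotopic_iff.1 hf
  refine PMap.homotopic_iff.2 ⟨fun x => Sum.elim (fun y : I × P => Sum.inl (H y))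
    (fun y => Sum.inr y.2) (Homeomorph.prodSumDistrib x), ?_, ?_, ?_, fun t => rfl⟩
  · exact ((continuous_inl.comp hH).sumElim (continuous_inr.comp continuous_snd)).comp
      Homeomorph.prodSumDistrib.continuous
  · rintro (x | x)
    · exact congrArg Sum.inl (h0 x)
    · rfl
  · rintro (x | x)
    · exact congrArg Sum.inl (h1 x)
    · rfl

theorem PHomotopyEquivalent.plus (hP : PHomotopyEquivalent P P') :
    PHomotopyEquivalent (plus P) (plus P') := by
  obtain ⟨f, g, hgf, hfg⟩ := hP
  refine ⟨plusMap f.toMap, plusMap g.toMap, ?_, ?_⟩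
  · convert plusMap_homotopic hgf using 1 <;> exact plus_ext fun _ => rfl
  · convert plusMap_homotopic hfg using 1 <;> exact plus_ext fun _ => rfl

theorem HasWellPointedCGType.smash (hP : HasWellPointedCGType P) (hQ : HasWellPointedCGType Q) :
    HasWellPointedCGType (smash P Q) := by
  obtain ⟨_, _, hP', e⟩ := hP
  obtain ⟨_, _, hQ', e'⟩ := hQ
  exact ⟨_, inferInstance, hP'.smash hQ', e.smash e'⟩

theorem HasWellPointedCGType.prod (hP : HasWellPointedCGType P) (hQ : HasWellPointedCGType Q) :
    HasWellPointedCGType (prod P Q) := by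
  obtain ⟨_, _, hP', e⟩ := hP
  obtain ⟨_, _, hQ', e'⟩ := hQ
  exact ⟨_, inferInstance, hP'.prod hQ', e.prod e'⟩

theorem HasWellPointedCGType.plus (hP : HasWellPointedCGType P) :
    HasWellPointedCGType (plus P) := by
  obtain ⟨P', _, -, e⟩ := hP
  exact ⟨_, inferInstance, wellPointed_plus P', e.plus⟩

theorem HasCGHType.smash (hP : HasCGHType P) (hQ : HasCGHType Q) : HasCGHType (smash P Q) := by
  obtain ⟨_, _, _, hP', e⟩ := hP
  obtain ⟨_, _, _, hQ', e'⟩ := hQ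
  exact ⟨_, hP'.t2Space_smash hQ', inferInstance, hP'.smash hQ', e.smash e'⟩

theorem HasCGHType.hasWellPointedCGType (hP : HasCGHType P) : HasWellPointedCGType P := by
  obtain ⟨Y, -, h⟩ := hP
  exact ⟨Y, h⟩

end HomotopyType

/-! ### Existence and uniqueness of the products -/

section WellDefined

variable {Γ P Q W P' Q' W' : PTop.{u}} {X : PTop.{v}}

/-- The inclusion of `P` in the wedge, the fibre of `P × Q → P ∧ Q`. -/
def wedgeInl (P Q : PTop.{u}) [UCompactlyGeneratedSpace.{u} P] : PMap P (fiber (smashMk P Q)) :=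
  fiberLift (smashMk P Q) (prodLift (PMap.id P) (PMap.const P Q)) fun _ =>
    smashMk_eq_pt (Or.inr rfl)

/-- The inclusion of `Q` in the wedge, the fibre of `P × Q → P ∧ Q`. -/
def wedgeInr (P Q : PTop.{u}) [UCompactlyGeneratedSpace.{u} Q] : PMap Q (fiber (smashMk P Q)) :=
  fiberLift (smashMk P Q) (prodLift (PMap.const Q P) (PMap.id Q)) fun _ =>
    smashMk_eq_pt (Or.inl rfl)

/-- The distributivity map `Γ(P ∨ Q) → ΓP ∨ ΓQ`, where `P ∨ Q` is the fibre of `P × Q → P ∧ Q`. -/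
def smashFiberToWedge (Γ P Q : PTop.{u}) :
    PMap (smash Γ (fiber (smashMk P Q))) (wedge (smash Γ P) (smash Γ Q)) where
  toMap.toFun x :=
    ⟨(smashMap (PMap.id Γ) ((prodFst P Q).comp (fiberIncl (smashMk P Q))) x,
      smashMap (PMap.id Γ) ((prodSnd P Q).comp (fiberIncl (smashMk P Q))) x), by
      obtain ⟨⟨γ, ⟨p, hp⟩⟩, rfl⟩ := (isQuotientMap_smashMk Γ _).surjective x
      exact (smashMk_eq_pt_iff.1 hp).imp (fun h => smashMk_eq_pt (Or.inr h))
        fun h => smashMk_eq_pt (Or.inr h)⟩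
  toMap.continuous_toFun := ((PMap.cont _).prodMk (PMap.cont _)).subtype_mk _
  map_pt := rfl

theorem copair_comp_smashFiberToWedge [UCompactlyGeneratedSpace.{u} P]
    [UCompactlyGeneratedSpace.{u} Q] (f : PMap (smash Γ (fiber (smashMk P Q))) X) :
    (copair (f.comp (smashMap (PMap.id Γ) (wedgeInl P Q)))
      (f.comp (smashMap (PMap.id Γ) (wedgeInr P Q)))).comp (smashFiberToWedge Γ P Q) = f := by
  refine smash_ext fun γ ⟨⟨a, b⟩, hab⟩ => ?_
  rcases smashMk_eq_pt_iff.1 hab with (rfl : a = P.pt) | (rfl : b = Q.pt)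
  · exact copair_right _ _ (smashMk_eq_pt (Or.inr rfl))
  · exact copair_left _ _ (smashMk_eq_pt (Or.inr rfl))

theorem hclass_smash_fiber_ext [UCompactlyGeneratedSpace.{u} P] [UCompactlyGeneratedSpace.{u} Q]
    {κ κ' : HClass (smash Γ (fiber (smashMk P Q))) X}
    (hl : gpull Γ (wedgeInl P Q) κ = gpull Γ (wedgeInl P Q) κ')
    (hr : gpull Γ (wedgeInr P Q) κ = gpull Γ (wedgeInr P Q) κ') : κ = κ' := by
  obtain ⟨f, rfl⟩ := κ.exists_cls_eq
  obtain ⟨f', rfl⟩ := κ'.exists_cls_eq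
  rw [← copair_comp_smashFiberToWedge f, ← copair_comp_smashFiberToWedge f', PMap.cls_eq_iff]
  exact (copair_homotopic (PMap.cls_eq_iff.1 hl) (PMap.cls_eq_iff.1 hr)).comp
    (PMap.Homotopic.refl _)

theorem gpull_injective_of_retract {q : PMap P Q} {q' : PMap P' Q'} {i : PMap Q Q'}
    {r : PMap Q' Q} {s : PMap P' P} (hri : (r.comp i).Homotopic (PMap.id Q))
    (hs : r.comp q' = q.comp s)
    (hq' : Function.Injective (gpull Γ q' : HClass (smash Γ Q') X → _)) :
    Function.Injective (gpull Γ q : HClass (smash Γ Q) X → _) := by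
  intro κ κ' hκ
  rw [← gpull_gpull_of_homotopic_id hri κ, ← gpull_gpull_of_homotopic_id hri κ']
  refine congrArg _ (hq' ?_)
  rw [gpull_gpull, gpull_gpull, hs, ← gpull_gpull, ← gpull_gpull, hκ]

theorem gpull_fiberIncl_plusId_surjective : Function.Surjective
    (gpull Γ (fiberIncl (plusId W)) : HClass (smash Γ (plus W)) X → _) := by
  let r : PMap (plus W) (fiber (plusId W)) := plusLift ⟨fun _ => ⟨Sum.inl W.pt, rfl⟩, by fun_prop⟩
  have hr : r.comp (fiberIncl (plusId W)) = PMap.id _ := PMap.ext_fun (by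
    rintro ⟨p | p, hp⟩
    · exact Subtype.ext (congrArg Sum.inl (hp : p = W.pt).symm)
    · rfl)
  exact fun κ => ⟨gpull Γ r κ, by rw [gpull_gpull, hr, gpull_id]⟩

theorem gpull_plusMap_toFox {V V' : Type u} [TopologicalSpace V] [TopologicalSpace V']
    (k : C(V, V')) (f : C(V', P)) (η : HClass (smash Γ P) X) :
    gpull Γ (plusMap k) (toFox Γ f η) = toFox Γ (f.comp k) η := by
  rw [toFox, toFox, gpull_gpull]
  exact congrArg (fun l => gpull Γ l η) (plus_ext fun _ => rfl)

theorem toFox_gpull {V : Type u} [TopologicalSpace V] (k : C(V, P)) (f : PMap P Q)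
    (η : HClass (smash Γ Q) X) : toFox Γ k (gpull Γ f η) = toFox Γ (f.toMap.comp k) η := by
  rw [toFox, toFox, gpull_gpull]
  exact congrArg (fun l => gpull Γ l η) (plus_ext fun _ => rfl)

variable [CoGroup Γ]

theorem gpull_fiberIncl_smashMk_surjective [UCompactlyGeneratedSpace.{u} P]
    [UCompactlyGeneratedSpace.{u} Q] : Function.Surjective
      (gpull Γ (fiberIncl (smashMk P Q)) : HClass (smash Γ (prod P Q)) X → _) := by
  intro κ
  refine ⟨gpull Γ (prodFst P Q) (gpull Γ (wedgeInl P Q) κ) *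
    gpull Γ (prodSnd P Q) (gpull Γ (wedgeInr P Q) κ), hclass_smash_fiber_ext ?_ ?_⟩
  · have hr : (((wedgeInr P Q).comp (prodSnd P Q)).comp (fiberIncl (smashMk P Q))).comp
      (wedgeInl P Q) = PMap.const _ _ := rfl
    simp only [gpull_mul, gpull_gpull, hr, gpull_const, mul_one]
    rfl
  · have hl : (((wedgeInl P Q).comp (prodFst P Q)).comp (fiberIncl (smashMk P Q))).comp
      (wedgeInr P Q) = PMap.const _ _ := rfl
    simp only [gpull_mul, gpull_gpull, hl, gpull_const, one_mul]
    rfl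

theorem gpull_smashMk_injective (hP : HasWellPointedCGType P) (hQ : HasWellPointedCGType Q) :
    Function.Injective (gpull Γ (smashMk P Q) : HClass (smash Γ (smash P Q)) X → _) := by
  obtain ⟨P', _, hP', f, g, hgf, -⟩ := hP
  obtain ⟨Q', _, hQ', k, l, hlk, -⟩ := hQ
  obtain ⟨M⟩ := hP'.nonempty_ndr
  obtain ⟨N⟩ := hQ'.nonempty_ndr
  exact gpull_injective_of_retract (s := prodMap g l) (smashMap_comp_homotopic_id hgf hlk) rfl
    ((collapse_smashMk P' Q').gpull_injective (M.wedge N) gpull_fiberIncl_smashMk_surjective)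

theorem IsGammaWhitehead.gpull {α : HClass (smash Γ P') X} {β : HClass (smash Γ Q') X}
    {κ : HClass (smash Γ (smash P' Q')) X} (h : IsGammaWhitehead α β κ) (f : PMap P P')
    (g : PMap Q Q') : IsGammaWhitehead (gpull Γ f α) (gpull Γ g β) (gpull Γ (smashMap f g) κ) := by
  have h_prod := congrArg (GammaFox.gpull Γ (prodMap f g)) h
  rw [gpull_commutator] at h_prod
  unfold IsGammaWhitehead
  simp only [gpull_gpull] at h_prod ⊢
  exact h_prod

theorem WellPointed.exists_isGammaWhitehead [UCompactlyGeneratedSpace.{u} P]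
    [UCompactlyGeneratedSpace.{u} Q] (hP : WellPointed P) (hQ : WellPointed Q)
    (μ : HClass (GammaFox.smash Γ P) X) (ν : HClass (GammaFox.smash Γ Q) X) :
    ∃ κ, IsGammaWhitehead μ ν κ := by
  obtain ⟨M⟩ := hP.nonempty_ndr
  obtain ⟨N⟩ := hQ.nonempty_ndr
  refine (collapse_smashMk P Q).exists_gpull_eq (M.wedge N) (hclass_smash_fiber_ext ?_ ?_)
  · have hr : ((prodSnd P Q).comp (fiberIncl (smashMk P Q))).comp (wedgeInl P Q) =
      PMap.const _ _ := rfl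
    simp only [gpull_commutator, gpull_gpull, hr, gpull_const, gpull_one,
      commutatorElement_one_right]
  · have hl : ((prodFst P Q).comp (fiberIncl (smashMk P Q))).comp (wedgeInr P Q) =
      PMap.const _ _ := rfl
    simp only [gpull_commutator, gpull_gpull, hl, gpull_const, gpull_one,
      commutatorElement_one_left]

theorem exists_isGammaWhitehead (hP : HasWellPointedCGType P) (hQ : HasWellPointedCGType Q)
    (μ : HClass (smash Γ P) X) (ν : HClass (smash Γ Q) X) : ∃ κ, IsGammaWhitehead μ ν κ := by
  obtain ⟨P', _, hP', f, g, hgf, -⟩ := hP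
  obtain ⟨Q', _, hQ', k, l, hlk, -⟩ := hQ
  obtain ⟨κ, hκ⟩ := hP'.exists_isGammaWhitehead hQ' (gpull Γ g μ) (gpull Γ l ν)
  rw [← gpull_gpull_of_homotopic_id hgf μ, ← gpull_gpull_of_homotopic_id hlk ν]
  exact ⟨_, hκ.gpull f k⟩

theorem existsUnique_isGammaWhitehead (hP : HasWellPointedCGType P) (hQ : HasWellPointedCGType Q)
    (μ : HClass (smash Γ P) X) (ν : HClass (smash Γ Q) X) : ∃! κ, IsGammaWhitehead μ ν κ := by
  obtain ⟨κ, hκ⟩ := exists_isGammaWhitehead hP hQ μ ν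
  exact ⟨κ, hκ, fun κ' hκ' => gpull_smashMk_injective hP hQ (hκ'.trans hκ.symm)⟩

theorem isGammaWhitehead_gammaWhitehead (hP : HasWellPointedCGType P)
    (hQ : HasWellPointedCGType Q) (μ : HClass (smash Γ P) X) (ν : HClass (smash Γ Q) X) :
    IsGammaWhitehead μ ν (gammaWhitehead μ ν) := by
  have h := exists_isGammaWhitehead hP hQ μ ν
  unfold gammaWhitehead
  rw [dif_pos h]
  exact h.choose_spec

theorem gpull_plusId_injective (hW : HasWellPointedCGType W) :
    Function.Injective (gpull Γ (plusId W) : HClass (smash Γ W) X → _) := by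
  obtain ⟨W', _, hW', f, g, hgf, -⟩ := hW
  obtain ⟨M⟩ := hW'.nonempty_ndr
  exact gpull_injective_of_retract (s := plusMap g.toMap) hgf (plus_ext fun _ => rfl)
    ((collapse_plusId W').gpull_injective M.plusId gpull_fiberIncl_plusId_surjective)

theorem IsConjAct.gpull {ξ : HClass (smash Γ S0) X} {η ζ : HClass (smash Γ W') X}
    (h : IsConjAct ξ η ζ) (f : PMap W W') : IsConjAct ξ (gpull Γ f η) (gpull Γ f ζ) := by
  have h_ξ : GammaFox.gpull Γ (plusMap f.toMap) (GammaFox.gpull Γ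
      (plusMap (ContinuousMap.const W' (PUnit.unit : PUnit.{u + 1}))) ξ) =
        GammaFox.gpull Γ (plusMap (ContinuousMap.const W PUnit.unit)) ξ :=
    (gpull_gpull _ _ _).trans
      (congrArg (fun k => GammaFox.gpull Γ k ξ) (plus_ext fun _ => rfl))
  have h_plus := congrArg (GammaFox.gpull Γ (plusMap f.toMap)) h
  rw [gpull_mul, gpull_mul, gpull_inv, gpull_plusMap_toFox, gpull_plusMap_toFox, h_ξ] at h_plus
  unfold IsConjAct
  rw [toFox_gpull, toFox_gpull]
  exact h_plus

theorem WellPointed.exists_isConjAct [UCompactlyGeneratedSpace.{u} W] (hW : WellPointed W)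
    (ξ : HClass (GammaFox.smash Γ S0) X) (η : HClass (GammaFox.smash Γ W) X) :
    ∃ ζ, IsConjAct ξ η ζ := by
  obtain ⟨M⟩ := hW.nonempty_ndr
  have h_fiber : (plusLift (ContinuousMap.id W)).comp (fiberIncl (plusId W)) = PMap.const _ _ :=
    PMap.ext_fun fun p => p.2
  refine (collapse_plusId W).exists_gpull_eq M.plusId ?_
  simp only [gpull_mul, gpull_inv, toFox, gpull_gpull, h_fiber, gpull_const, mul_one,
    mul_inv_cancel]

theorem exists_isConjAct (hW : HasWellPointedCGType W) (ξ : HClass (smash Γ S0) X)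
    (η : HClass (smash Γ W) X) : ∃ ζ, IsConjAct ξ η ζ := by
  obtain ⟨W', _, hW', f, g, hgf, -⟩ := hW
  obtain ⟨ζ, hζ⟩ := hW'.exists_isConjAct ξ (gpull Γ g η)
  rw [← gpull_gpull_of_homotopic_id hgf η]
  exact ⟨_, hζ.gpull f⟩

theorem existsUnique_isConjAct (hW : HasWellPointedCGType W) (ξ : HClass (smash Γ S0) X)
    (η : HClass (smash Γ W) X) : ∃! ζ, IsConjAct ξ η ζ := by
  obtain ⟨ζ, hζ⟩ := exists_isConjAct hW ξ η
  exact ⟨ζ, hζ, fun ζ' hζ' => gpull_plusId_injective hW (hζ'.trans hζ.symm)⟩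

theorem isConjAct_conjAct (hW : HasWellPointedCGType W) (ξ : HClass (smash Γ S0) X)
    (η : HClass (smash Γ W) X) : IsConjAct ξ η (conjAct ξ η) := by
  have h := exists_isConjAct hW ξ η
  unfold conjAct
  rw [dif_pos h]
  exact h.choose_spec

end WellDefined

theorem gpull_smashMk_prodLift {Γ M A B : PTop.{u}} {X : PTop.{v}} [CoGroup Γ]
    [UCompactlyGeneratedSpace.{u} M] (hA : HasWellPointedCGType A) (hB : HasWellPointedCGType B)
    (x : PMap M A) (y : PMap M B) (α : HClass (smash Γ A) X) (β : HClass (smash Γ B) X) :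
    gpull Γ ((smashMk A B).comp (prodLift x y)) (gammaWhitehead α β) =
      ⁅gpull Γ x α, gpull Γ y β⁆ := by
  rw [← gpull_gpull, isGammaWhitehead_gammaWhitehead hA hB α β, gpull_commutator, gpull_gpull,
    gpull_gpull]
  rfl

/-! ### Threefold smash products -/

section Triple

variable {Γ A B C M : PTop.{u}} {X : PTop.{v}}

/-- The map `(Γ ∧ C) ∧ D → Γ ∧ (D ∧ C)`. -/
def smashShift (Γ C D : PTop.{u}) : PMap (smash (smash Γ C) D) (smash Γ (smash D C)) :=
  smash3Lift ((smashMk Γ (smash D C)).comp (prodLift (pr1 Γ C D)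
    ((smashMk D C).comp (prodLift (pr3 Γ C D) (pr2 Γ C D))))) fun γ c d h => by
      refine smashMk_eq_pt (h.imp id fun h => ?_)
      exact smashMk_eq_pt (p := KProd.mk d c) h.symm

/-- The map `Γ ∧ (D × C) → (Γ ∧ C) ∧ D`, which induces an inverse of `smashShift`. -/
def smashUnshift (Γ C D : PTop.{u}) : PMap (smash Γ (prod D C)) (smash (smash Γ C) D) :=
  smashLift ((smash3Mk Γ C D).comp (prodLift (prodLift (prodFst _ _)
    ((prodSnd D C).comp (prodSnd _ _))) ((prodFst D C).comp (prodSnd _ _)))) fun p h =>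
      smash3Mk_eq_pt (a := p.1) (b := p.2.2) (c := p.2.1)
        (h.imp id fun h => Or.inl (congrArg (fun q : prod D C => q.2) h))

theorem exists_smashShift_comp_eq_id (Γ C D : PTop.{u}) :
    ∃ f : PMap (smash Γ (smash D C)) (smash (smash Γ C) D),
      (smashShift Γ C D).comp f = PMap.id _ := by
  obtain ⟨f, hf⟩ := (collapse_smashMk D C).exists_comp_eq (f := smashUnshift Γ C D) (fun x => by
    obtain ⟨⟨γ, ⟨⟨d, c⟩, hp⟩⟩, rfl⟩ := (isQuotientMap_smashMk Γ _).surjective x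
    exact smash3Mk_eq_pt (a := γ) (b := c) (c := d) (Or.inr (smashMk_eq_pt_iff.1 hp).symm))
  refine ⟨f, PMap.ext_fun fun z => ?_⟩
  obtain ⟨x, rfl⟩ := (isQuotientMap_smashMap_id Γ (isQuotientMap_smashMk D C)).surjective z
  obtain ⟨p, rfl⟩ := (isQuotientMap_smashMk Γ _).surjective x
  exact congrArg (fun g => smashShift Γ C D (PMap.toMap g (smashMk Γ (prod D C) p))) hf

theorem smashShift_comp_smashMap (Γ : PTop.{u}) {D D' : PTop.{u}} (q : PMap D D') :
    (smashShift Γ C D').comp (smashMap (PMap.id (smash Γ C)) q) =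
      (smashMap (PMap.id Γ) (smashMap q (PMap.id C))).comp (smashShift Γ C D) := by
  refine smash_ext fun x d => ?_
  obtain ⟨⟨γ, c⟩, rfl⟩ := (isQuotientMap_smashMk _ _).surjective x
  rfl

variable [CoGroup Γ]

theorem gpull_smashMap_smashMk_injective (hA : HasWellPointedCGType A)
    (hB : HasWellPointedCGType B) :
    Function.Injective (gpull Γ (smashMap (smashMk A B) (PMap.id C)) :
      HClass (smash Γ (smash (smash A B) C)) X → _) := by
  intro κ κ' h
  obtain ⟨f, hf⟩ := exists_smashShift_comp_eq_id Γ C (smash A B)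
  have h_shift : HClass.pull (smashShift Γ C (smash A B)) κ =
      HClass.pull (smashShift Γ C (smash A B)) κ' := by
    refine gpull_smashMk_injective (Γ := smash Γ C) hA hB ?_
    unfold gpull
    rw [HClass.pull_comp, HClass.pull_comp, smashShift_comp_smashMap, ← HClass.pull_comp,
      ← HClass.pull_comp]
    exact congrArg _ h
  have h_unshift := congrArg (HClass.pull f) h_shift
  rwa [HClass.pull_comp, HClass.pull_comp, hf, HClass.pull_id, HClass.pull_id] at h_unshift

theorem gpull_smash3Mk_injective (hA : HasWellPointedCGType A) (hB : HasWellPointedCGType B)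
    (hC : HasWellPointedCGType C) : Function.Injective (gpull Γ (smash3Mk A B C) :
      HClass (smash Γ (smash (smash A B) C)) X → _) := by
  intro κ κ' h
  refine gpull_smashMap_smashMk_injective hA hB (gpull_smashMk_injective (hA.prod hB) hC ?_)
  rw [gpull_gpull, gpull_gpull]
  exact h

theorem gpull_smash3Mk_prodLift [UCompactlyGeneratedSpace.{u} M] (hA : HasWellPointedCGType A)
    (hB : HasWellPointedCGType B) (hC : HasWellPointedCGType C) (x : PMap M A) (y : PMap M B)
    (z : PMap M C) (α : HClass (smash Γ A) X) (β : HClass (smash Γ B) X)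
    (γ : HClass (smash Γ C) X) :
    gpull Γ ((smash3Mk A B C).comp (prodLift (prodLift x y) z))
        (gammaWhitehead (gammaWhitehead α β) γ) =
      ⁅⁅gpull Γ x α, gpull Γ y β⁆, gpull Γ z γ⁆ := by
  rw [← gpull_smashMk_prodLift hA hB, ← gpull_smashMk_prodLift (hA.smash hB) hC]
  rfl

end Triple

/-! ### Products of unpointed classes -/

section Fox

variable {Γ A B C P Q M : PTop.{u}} {X : PTop.{v}}

theorem gpull_plusMap_plusMap {V V' V'' : Type u} [TopologicalSpace V] [TopologicalSpace V']
    [TopologicalSpace V''] (k : C(V, V')) (l : C(V', V'')) (a : FoxGroup Γ V'' X) :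
    gpull Γ (plusMap k) (gpull Γ (plusMap l) a) = gpull Γ (plusMap (l.comp k)) a := by
  rw [gpull_gpull]
  exact congrArg (fun f => gpull Γ f a) (plus_ext fun _ => rfl)

variable [CoGroup Γ]

theorem toFox_commutator {V : Type u} [TopologicalSpace V] (f : C(V, A))
    (α β : HClass (smash Γ A) X) : toFox Γ f ⁅α, β⁆ = ⁅toFox Γ f α, toFox Γ f β⁆ :=
  gpull_commutator _ _ _

theorem toFox_inv {V : Type u} [TopologicalSpace V] (f : C(V, A)) (α : HClass (smash Γ A) X) :
    toFox Γ f α⁻¹ = (toFox Γ f α)⁻¹ := gpull_inv _ _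

theorem foxWhitehead_eq (hA : HasWellPointedCGType A) (hB : HasWellPointedCGType B)
    (a : FoxGroup Γ A X) (b : FoxGroup Γ B X) : foxWhitehead a b =
      ⁅gpull Γ (plusMap (prodFst A B).toMap) a, gpull Γ (plusMap (prodSnd A B).toMap) b⁆ := by
  have h : plusProd A B = (smashMk (plus A) (plus B)).comp
      (prodLift (plusMap (prodFst A B).toMap) (plusMap (prodSnd A B).toMap)) :=
    plus_ext fun _ => rfl
  rw [foxWhitehead, h, gpull_smashMk_prodLift hA.plus hB.plus]

theorem gpull_plusMap_foxWhitehead [UCompactlyGeneratedSpace.{u} M] (hA : HasWellPointedCGType A)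
    (hB : HasWellPointedCGType B) (x : PMap M A) (y : PMap M B) (a : FoxGroup Γ A X)
    (b : FoxGroup Γ B X) : gpull Γ (plusMap (prodLift x y).toMap) (foxWhitehead a b) =
      ⁅gpull Γ (plusMap x.toMap) a, gpull Γ (plusMap y.toMap) b⁆ := by
  rw [foxWhitehead_eq hA hB, gpull_commutator, gpull_plusMap_plusMap, gpull_plusMap_plusMap]
  rfl

theorem gpull_plusMap_foxWhitehead_foxWhitehead [UCompactlyGeneratedSpace.{u} M]
    (hA : HasWellPointedCGType A) (hB : HasWellPointedCGType B) (hC : HasWellPointedCGType C)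
    (x : PMap M A) (y : PMap M B) (z : PMap M C) (a : FoxGroup Γ A X) (b : FoxGroup Γ B X)
    (c : FoxGroup Γ C X) :
    gpull Γ (plusMap (prodLift (prodLift x y) z).toMap) (foxWhitehead (foxWhitehead a b) c) =
      ⁅⁅gpull Γ (plusMap x.toMap) a, gpull Γ (plusMap y.toMap) b⁆,
        gpull Γ (plusMap z.toMap) c⁆ := by
  rw [gpull_plusMap_foxWhitehead (hA.prod hB) hC, gpull_plusMap_foxWhitehead hA hB]

theorem foxWhitehead_toFox (hP : HasWellPointedCGType P) (hQ : HasWellPointedCGType Q)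
    (hA : HasWellPointedCGType A) (hB : HasWellPointedCGType B) (f : PMap P A) (g : PMap Q B)
    (α : HClass (smash Γ A) X) (β : HClass (smash Γ B) X) :
    foxWhitehead (toFox Γ f.toMap α) (toFox Γ g.toMap β) =
      toFox Γ ((smashMk A B).comp (prodMap f g)).toMap (gammaWhitehead α β) := by
  have h := gpull_smashMk_prodLift hA hB (f.comp (prodFst P Q)) (g.comp (prodSnd P Q)) α β
  rw [foxWhitehead_eq hP hQ, gpull_plusMap_toFox, gpull_plusMap_toFox]
  exact ((toFox_gpull (ContinuousMap.id _) _ _).symm.trans ((congrArg _ h).trans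
    (by rw [toFox_commutator, toFox_gpull, toFox_gpull]; rfl))).symm

theorem foxWhitehead_foxWhitehead_toFox (hA : HasWellPointedCGType A)
    (hB : HasWellPointedCGType B) (hC : HasWellPointedCGType C) (α : HClass (smash Γ A) X)
    (β : HClass (smash Γ B) X) (γ : HClass (smash Γ C) X) :
    foxWhitehead (foxWhitehead (toFox Γ (ContinuousMap.id A) α) (toFox Γ (ContinuousMap.id B) β))
      (toFox Γ (ContinuousMap.id C) γ) =
        toFox Γ (smash3Mk A B C).toMap (gammaWhitehead (gammaWhitehead α β) γ) := by
  have h := foxWhitehead_toFox hA hB hA hB (PMap.id A) (PMap.id B) α β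
  exact (congrArg (foxWhitehead · _) h).trans
    (foxWhitehead_toFox (hA.prod hB) hC (hA.smash hB) hC (smashMk A B) (PMap.id C) _ γ)

end Fox

/-! ### Identities in groups -/

section Identity

variable {G : Type*} [_root_.Group G] {a b c : G}

theorem hall_witt (a b c : G) :
    b * ⁅⁅b⁻¹, a⁆, c⁆ * b⁻¹ * (c * ⁅⁅c⁻¹, b⁆, a⁆ * c⁻¹) * (a * ⁅⁅a⁻¹, c⁆, b⁆ * a⁻¹) = 1 := by
  simpa only [mul_assoc] using conj_commutatorElement_left_commutatorElement_mul b a c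

theorem commutatorElement_inv_eq (h : Commute b ⁅a, b⁆) : ⁅b⁻¹, a⁆ = ⁅a, b⁆ := by
  have h_conj : ⁅b⁻¹, a⁆ = b⁻¹ * ⁅a, b⁆ * b := by
    simp only [commutatorElement_def]
    group
  rw [h_conj, h.inv_left.eq, inv_mul_cancel_right]

theorem jacobi_of_commute (h₁ : Commute b ⁅a, b⁆) (h₂ : Commute c ⁅b, c⁆) (h₃ : Commute a ⁅c, a⁆)
    (k₁ : Commute b ⁅⁅a, b⁆, c⁆) (k₂ : Commute c ⁅⁅b, c⁆, a⁆) (k₃ : Commute a ⁅⁅c, a⁆, b⁆)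
    (l : Commute ⁅⁅c, a⁆, b⁆ ⁅⁅b, c⁆, a⁆) : ⁅⁅a, b⁆, c⁆ * ⁅⁅c, a⁆, b⁆ * ⁅⁅b, c⁆, a⁆ = 1 := by
  have h := hall_witt a b c
  rw [commutatorElement_inv_eq h₁, commutatorElement_inv_eq h₂, commutatorElement_inv_eq h₃,
    k₁.eq, k₂.eq, k₃.eq, mul_inv_cancel_right, mul_inv_cancel_right, mul_inv_cancel_right] at h
  rw [mul_assoc, l.eq, ← mul_assoc, h]

end Identity

/-! ### Classes relative to a coordinate -/

section Coordinate

variable {Γ M B T Z Z' W : PTop.{u}} {X : PTop.{v}}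

theorem HomotopyCocommutative.commute [CoGroup Z] (h : HomotopyCocommutative Z)
    (κ ν : HClass Z X) : Commute κ ν := by
  obtain ⟨f, rfl⟩ := κ.exists_cls_eq
  obtain ⟨g, rfl⟩ := ν.exists_cls_eq
  have h_swap : (copair f g).comp ((wedgeSwap Z Z).comp CoGroup.comul) = mulMap g f := by
    refine PMap.ext_fun fun z => ?_
    change copair f g (wedgeSwap Z Z (CoGroup.comul z)) = copair g f (CoGroup.comul z)
    generalize (CoGroup.comul z : wedge Z Z) = p
    rcases p.2 with hp | hp
    · rw [copair_right g f hp, copair_left f g (by exact hp)]; rfl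
    · rw [copair_left g f hp, copair_right f g (by exact hp)]; rfl
  have h_comp := (PMap.Homotopic.refl (copair f g)).comp h
  rw [h_swap] at h_comp
  exact (PMap.cls_eq_iff.2 h_comp : (mulMap g f).cls = (mulMap f g).cls).symm

theorem HomotopyCocommutative.smash_right [CoGroup Z] (h : HomotopyCocommutative Z)
    (T : PTop.{u}) : HomotopyCocommutative (smash Z T) := by
  have h_comp :=
    (PMap.Homotopic.refl (smashDistrib Z Z T)).comp (smashMap_homotopic h (PMap.id T))
  unfold HomotopyCocommutative
  convert h_comp using 1
  · exact smash_ext fun _ _ => rfl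
  · rfl

/-- A coordinate of `M`: a map for which the value at a point can be replaced, continuously, by an
arbitrary one. -/
def IsCoordinate (f : PMap M B) : Prop :=
  ∃ μ : PMap (prod B M) M, (∀ p, f (μ p) = p.1) ∧ ∀ m, μ (KProd.mk (f m) m) = m

theorem isCoordinate_pr1 (A B C : PTop.{u}) : IsCoordinate (pr1 A B C) :=
  ⟨prodLift (prodLift (prodFst _ _) ((pr2 A B C).comp (prodSnd _ _)))
    ((pr3 A B C).comp (prodSnd _ _)), fun _ => rfl, fun _ => rfl⟩

theorem isCoordinate_pr2 (A B C : PTop.{u}) : IsCoordinate (pr2 A B C) :=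
  ⟨prodLift (prodLift ((pr1 A B C).comp (prodSnd _ _)) (prodFst _ _))
    ((pr3 A B C).comp (prodSnd _ _)), fun _ => rfl, fun _ => rfl⟩

theorem isCoordinate_pr3 (A B C : PTop.{u}) : IsCoordinate (pr3 A B C) :=
  ⟨prodLift (prodLift ((pr1 A B C).comp (prodSnd _ _)) ((pr2 A B C).comp (prodSnd _ _)))
    (prodFst _ _), fun _ => rfl, fun _ => rfl⟩

/-- The map `ΓM → ΓB ∧ (M ⊔ *)` that records the coordinate `f`. -/
def halfSmash (Γ : PTop.{u}) (f : PMap M B) :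
    PMap (smash Γ M) (smash (smash Γ B) (plus M)) :=
  smashLift ⟨⟨fun p => smash3Mk Γ B (plus M) (KProd.mk (KProd.mk p.1 (f p.2)) (Sum.inl p.2)),
    (smash3Mk Γ B (plus M)).cont.comp (KProd.continuous_mk
      (KProd.continuous_mk (prodFst Γ M).cont (f.comp (prodSnd Γ M)).cont)
      (continuous_inl.comp (prodSnd Γ M).cont))⟩,
    smash3Mk_eq_pt (Or.inl rfl)⟩ fun p h => smash3Mk_eq_pt (a := p.1) (b := f p.2)
      (h.imp id fun h => Or.inl ((congrArg f h).trans f.map_pt))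

theorem isCoHom_halfSmash [CoGroup Γ] (f : PMap M B) : IsCoHom (halfSmash Γ f) :=
  smash_ext fun _ _ => rfl

theorem continuous_elim_const (k : PMap (prod B T) Z) : Continuous fun p : prod B (plus T) =>
    Sum.elim (fun t => k (KProd.mk p.1 t)) (fun _ => Z.pt) p.2 := by
  refine KProd.continuous_dom fun S _ _ _ a v ha hv => ?_
  have h_inl : IsClosed (v ⁻¹' Set.range Sum.inl) := isClosed_range_inl.preimage hv
  have h_inr : IsClosed (v ⁻¹' Set.range Sum.inr) := isClosed_range_inr.preimage hv
  refine continuous_of_isClosed_cover h_inl h_inr (fun s => ?_) ?_ ?_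
  · rcases hs : v s with t | t
    · exact Or.inl ⟨t, hs.symm⟩
    · exact Or.inr ⟨t, hs.symm⟩
  · have := isCompact_iff_compactSpace.1 h_inl.isCompact
    choose t ht using fun s : v ⁻¹' Set.range Sum.inl => s.2
    have h_cont : Continuous t := IsEmbedding.inl.continuous_iff.2
      ((hv.comp continuous_subtype_val).congr fun s => (ht s).symm)
    refine (k.cont.comp (KProd.continuous_test (ha.comp continuous_subtype_val) h_cont)).congr
      fun s => ?_
    change k (KProd.mk (a s) (t s)) = Sum.elim _ _ (v s)
    rw [← ht s]
    rfl
  · refine continuous_const.congr (f := fun _ => Z.pt) fun s => ?_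
    obtain ⟨y, hy⟩ := s.2
    change _ = Sum.elim _ _ (v s)
    rw [← hy]
    rfl

/-- The extension of a map on `B × T` to `B × (T ⊔ *)`, constant on the added part. -/
def extendPlus (k : PMap (prod B T) Z) : PMap (prod B (plus T)) Z :=
  ⟨⟨fun p => Sum.elim (fun t => k (KProd.mk p.1 t)) (fun _ => Z.pt) p.2,
    continuous_elim_const k⟩, rfl⟩

theorem extendPlus_eq_pt {k : PMap (prod B T) Z} (hk : ∀ t, k (KProd.mk B.pt t) = Z.pt)
    (b : B) (t : plus T) (h : b = B.pt ∨ t = (plus T).pt) :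
    extendPlus k (KProd.mk b t) = Z.pt := by
  rcases h with rfl | rfl
  · rcases t with t | t
    · exact hk t
    · rfl
  · rfl

theorem IsCoordinate.exists_comp_halfSmash {f : PMap M B} (hf : IsCoordinate f) (Γ : PTop.{u})
    (k : PMap M Z) (hk : ∀ m, f m = B.pt → k m = Z.pt) :
    ∃ l : PMap (smash (smash Γ B) (plus M)) (smash Γ Z),
      l.comp (halfSmash Γ f) = smashMap (PMap.id Γ) k := by
  obtain ⟨μ, hμ, hμ'⟩ := hf
  refine ⟨smash3Lift ((smashMk Γ Z).comp (prodLift (pr1 Γ B (plus M))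
    ((extendPlus (k.comp μ)).comp (prodLift (pr2 Γ B (plus M)) (pr3 Γ B (plus M))))))
    fun γ b m h => ?_, smash_ext fun γ m => ?_⟩
  · exact smashMk_eq_pt (h.imp id fun h =>
      extendPlus_eq_pt (k := k.comp μ) (fun m => hk _ (hμ (KProd.mk B.pt m))) b m h)
  · exact congrArg (fun n => smashMk Γ Z (KProd.mk γ (k n))) (hμ' m)

/-- The classes on `ΓM` that are induced by a map of `M` which is trivial where the coordinate `f`
is. -/
def IsRelative (Γ : PTop.{u}) (f : PMap M B) (κ : HClass (smash Γ M) X) : Prop :=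
  ∃ (Z : PTop.{u}) (k : PMap M Z) (ζ : HClass (smash Γ Z) X), HasWellPointedCGType Z ∧
    (∀ m, f m = B.pt → k m = Z.pt) ∧ gpull Γ k ζ = κ

theorem isRelative_gpull (hB : HasWellPointedCGType B) (f : PMap M B)
    (β : HClass (smash Γ B) X) : IsRelative Γ f (gpull Γ f β) :=
  ⟨B, f, β, hB, fun _ => id, rfl⟩

variable [CoGroup Γ]

theorem IsCoordinate.commute_gpull {f : PMap M B} (hf : IsCoordinate f)
    (h : HomotopyCocommutative (smash Γ B)) {k : PMap M Z} (hk : ∀ m, f m = B.pt → k m = Z.pt)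
    {k' : PMap M Z'} (hk' : ∀ m, f m = B.pt → k' m = Z'.pt) (ζ : HClass (smash Γ Z) X)
    (ζ' : HClass (smash Γ Z') X) : Commute (gpull Γ k ζ) (gpull Γ k' ζ') := by
  obtain ⟨l, hl⟩ := hf.exists_comp_halfSmash Γ k hk
  obtain ⟨l', hl'⟩ := hf.exists_comp_halfSmash Γ k' hk'
  unfold gpull Commute SemiconjBy
  rw [← hl, ← hl', ← HClass.pull_comp, ← HClass.pull_comp, ← (isCoHom_halfSmash f).pull_mul,
    ← (isCoHom_halfSmash f).pull_mul, ((h.smash_right (plus M)).commute _ _).eq]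

theorem IsRelative.commute {f : PMap M B} (hf : IsCoordinate f)
    (h : HomotopyCocommutative (smash Γ B)) {κ ν : HClass (smash Γ M) X}
    (hκ : IsRelative Γ f κ) (hν : IsRelative Γ f ν) : Commute κ ν := by
  obtain ⟨Z, k, ζ, -, hk, rfl⟩ := hκ
  obtain ⟨Z', k', ζ', -, hk', rfl⟩ := hν
  exact hf.commute_gpull h hk hk' ζ ζ'

theorem IsRelative.commutator_left [UCompactlyGeneratedSpace.{u} M] (hM : HasWellPointedCGType M)
    {f : PMap M B} {κ : HClass (smash Γ M) X} (hκ : IsRelative Γ f κ) (ν : HClass (smash Γ M) X) :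
    IsRelative Γ f ⁅κ, ν⁆ := by
  obtain ⟨Z, k, ζ, hZ, hk, rfl⟩ := hκ
  refine ⟨smash Z M, (smashMk Z M).comp (prodLift k (PMap.id M)), gammaWhitehead ζ ν, hZ.smash hM,
    fun m hm => smashMk_eq_pt (Or.inl (hk m hm)), ?_⟩
  rw [gpull_smashMk_prodLift hZ hM, gpull_id]

theorem IsRelative.commutator_right [UCompactlyGeneratedSpace.{u} M] (hM : HasWellPointedCGType M)
    {f : PMap M B} {κ : HClass (smash Γ M) X} (hκ : IsRelative Γ f κ) (ν : HClass (smash Γ M) X) :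
    IsRelative Γ f ⁅ν, κ⁆ := by
  obtain ⟨Z, k, ζ, hZ, hk, rfl⟩ := hκ
  refine ⟨smash M Z, (smashMk M Z).comp (prodLift (PMap.id M) k), gammaWhitehead ν ζ, hM.smash hZ,
    fun m hm => smashMk_eq_pt (Or.inr (hk m hm)), ?_⟩
  rw [gpull_smashMk_prodLift hM hZ, gpull_id]

end Coordinate

/-! ### The conjugation action -/

section Action

variable {Γ M B W : PTop.{u}} {X : PTop.{v}}

theorem exists_plus_lift (e : S0 ≃ₜ B) (he : e S0.pt = B.pt) (f : PMap M B) (k : PMap M W)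
    (hk : ∀ m, f m = B.pt → k m = W.pt) : ∃ θ : PMap M (plus W),
      (plusLift (ContinuousMap.id W)).comp θ = k ∧ (⟨⟨e, e.continuous⟩, he⟩ : PMap S0 B).comp
        ((plusMap (ContinuousMap.const W PUnit.unit)).comp θ) = f := by
  have h_pt (m : M) : f m = B.pt ↔ ∃ y, e.symm (f m) = Sum.inr y :=
    ⟨fun h => ⟨PUnit.unit, by rw [h, ← he, e.symm_apply_apply]; rfl⟩,
      fun ⟨y, hy⟩ => by rw [← he, ← e.apply_symm_apply (f m), hy]; rfl⟩
  let θ (m : M) : W ⊕ PUnit := Sum.map (fun y => k y.1) (fun y => y.2)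
    (Homeomorph.prodSumDistrib (X := M) (Y := PUnit) (Z := PUnit) (m, e.symm (f m)))
  have hθ : Continuous θ :=
    ((k.cont.comp continuous_fst).sumMap continuous_snd).comp
      ((Homeomorph.prodSumDistrib (X := M) (Y := PUnit) (Z := PUnit)).continuous.comp
        (continuous_id.prodMk (e.symm.continuous.comp f.cont)))
  have hθ_inl (m : M) (y : PUnit) (hm : e.symm (f m) = Sum.inl y) : θ m = Sum.inl (k m) := by
    simp only [θ, hm]; rfl
  have hθ_inr (m : M) (y : PUnit) (hm : e.symm (f m) = Sum.inr y) : θ m = Sum.inr y := by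
    simp only [θ, hm]; rfl
  obtain ⟨_, h_base⟩ := (h_pt M.pt).1 f.map_pt
  refine ⟨⟨⟨θ, hθ⟩, hθ_inr _ _ h_base⟩, PMap.ext_fun fun m => ?_, PMap.ext_fun fun m => ?_⟩
  · change Sum.elim _ _ (θ m) = k m
    rcases hm : e.symm (f m) with y | y
    · rw [hθ_inl m y hm]; rfl
    · rw [hθ_inr m y hm, hk m ((h_pt m).2 ⟨y, hm⟩)]; rfl
  · change e (Sum.elim _ _ (θ m)) = f m
    refine Eq.trans ?_ (e.apply_symm_apply (f m))
    rcases hm : e.symm (f m) with y | y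
    · rw [hθ_inl m y hm]; rfl
    · rw [hθ_inr m y hm]; rfl

variable [CoGroup Γ]

theorem gpull_conjAct (hW : HasWellPointedCGType W) (ε : PMap S0 B) (β : HClass (smash Γ B) X)
    (η : HClass (smash Γ W) X) (θ : PMap M (plus W)) {f : PMap M B}
    (hf : ε.comp ((plusMap (ContinuousMap.const W PUnit.unit)).comp θ) = f) :
    gpull Γ ((plusLift (ContinuousMap.id W)).comp θ) (conjAct (gpull Γ ε β) η) =
      gpull Γ f β * gpull Γ ((plusLift (ContinuousMap.id W)).comp θ) η * (gpull Γ f β)⁻¹ := by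
  have h_base : gpull Γ θ (gpull Γ (plusMap (ContinuousMap.const W PUnit.unit)) (gpull Γ ε β)) =
      gpull Γ f β :=
    (gpull_gpull _ _ _).trans ((gpull_gpull _ _ _).trans (congrArg (gpull Γ · β) hf))
  have h_conj := congrArg (gpull Γ θ) (isConjAct_conjAct hW (gpull Γ ε β) η)
  unfold toFox at h_conj
  rw [gpull_mul, gpull_mul, gpull_inv, gpull_gpull, gpull_gpull] at h_conj
  exact h_conj.trans (congrArg (fun ω => ω * gpull Γ _ η * ω⁻¹) h_base)

theorem gpull_dotAct {f : PMap M B} (hf : IsCoordinate f)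
    (h : HomotopyCocommutative (smash Γ B) ∨ IsS0 B) (hW : HasWellPointedCGType W) {k : PMap M W}
    (hk : ∀ m, f m = B.pt → k m = W.pt) (β : HClass (smash Γ B) X) (η : HClass (smash Γ W) X) :
    gpull Γ k (dotAct β η) = gpull Γ f β * gpull Γ k η * (gpull Γ f β)⁻¹ := by
  unfold dotAct
  split_ifs with hS
  · obtain ⟨θ, hθ_fold, hθ_base⟩ := exists_plus_lift hS.choose hS.choose_spec f k hk
    have h_conj := gpull_conjAct hW _ β η θ hθ_base
    rwa [hθ_fold] at h_conj
  · rw [(hf.commute_gpull (h.resolve_right hS) (fun _ => id) hk β η).eq, mul_inv_cancel_right]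

end Action

/-! ### The Hall–Witt and Jacobi identities -/

section Identities

variable {Γ A B C : PTop.{u}} [CoGroup Γ] {X : PTop.{v}}

theorem foxWhitehead_hall_witt (hA : HasWellPointedCGType A) (hB : HasWellPointedCGType B)
    (hC : HasWellPointedCGType C) (a : FoxGroup Γ A X) (b : FoxGroup Γ B X)
    (c : FoxGroup Γ C X) :
    gpull Γ (plusMap (pr2 A B C).toMap) b *
          gpull Γ (plusMap (t213 A B C).toMap) (foxWhitehead (foxWhitehead b⁻¹ a) c) *
          (gpull Γ (plusMap (pr2 A B C).toMap) b)⁻¹ *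
        (gpull Γ (plusMap (pr3 A B C).toMap) c *
          gpull Γ (plusMap (t321 A B C).toMap) (foxWhitehead (foxWhitehead c⁻¹ b) a) *
          (gpull Γ (plusMap (pr3 A B C).toMap) c)⁻¹) *
      (gpull Γ (plusMap (pr1 A B C).toMap) a *
        gpull Γ (plusMap (t132 A B C).toMap) (foxWhitehead (foxWhitehead a⁻¹ c) b) *
        (gpull Γ (plusMap (pr1 A B C).toMap) a)⁻¹) = 1 := by
  rw [t213, t321, t132, gpull_plusMap_foxWhitehead_foxWhitehead hB hA hC,
    gpull_plusMap_foxWhitehead_foxWhitehead hC hB hA,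
    gpull_plusMap_foxWhitehead_foxWhitehead hA hC hB, gpull_inv, gpull_inv, gpull_inv, hall_witt]

theorem gammaWhitehead_jacobi (hA : HasWellPointedCGType A) (hB : HasWellPointedCGType B)
    (hC : HasWellPointedCGType C) (α : HClass (smash Γ A) X) (β : HClass (smash Γ B) X)
    (γ : HClass (smash Γ C) X) (cA : HomotopyCocommutative (smash Γ A))
    (cB : HomotopyCocommutative (smash Γ B)) (cC : HomotopyCocommutative (smash Γ C)) :
    gammaWhitehead (gammaWhitehead α β) γ *
      gpull Γ (s312 A B C) (gammaWhitehead (gammaWhitehead γ α) β) *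
      gpull Γ (s231 A B C) (gammaWhitehead (gammaWhitehead β γ) α) = 1 := by
  have hM := (hA.prod hB).prod hC
  have ha := isRelative_gpull hA (pr1 A B C) α
  have hb := isRelative_gpull hB (pr2 A B C) β
  have hc := isRelative_gpull hC (pr3 A B C) γ
  have commute_a {κ ν} := IsRelative.commute (X := X) (κ := κ) (ν := ν) (isCoordinate_pr1 A B C) cA
  have commute_b {κ ν} := IsRelative.commute (X := X) (κ := κ) (ν := ν) (isCoordinate_pr2 A B C) cB
  have commute_c {κ ν} := IsRelative.commute (X := X) (κ := κ) (ν := ν) (isCoordinate_pr3 A B C) cC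
  have h_jacobi := jacobi_of_commute (commute_b hb (hb.commutator_right hM _))
    (commute_c hc (hc.commutator_right hM _)) (commute_a ha (ha.commutator_right hM _))
    (commute_b hb ((hb.commutator_right hM _).commutator_left hM _))
    (commute_c hc ((hc.commutator_right hM _).commutator_left hM _))
    (commute_a ha ((ha.commutator_right hM _).commutator_left hM _))
    (commute_b (hb.commutator_right hM _) ((hb.commutator_left hM _).commutator_left hM _))
  refine gpull_smash3Mk_injective hA hB hC ?_
  rw [← gpull_smash3Mk_prodLift hA hB hC, ← gpull_smash3Mk_prodLift hC hA hB,
    ← gpull_smash3Mk_prodLift hB hC hA] at h_jacobi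
  rw [gpull_mul, gpull_mul, gpull_gpull, gpull_gpull, gpull_one]
  exact h_jacobi

theorem gammaWhitehead_hall_witt (hA : HasWellPointedCGType A) (hB : HasWellPointedCGType B)
    (hC : HasWellPointedCGType C) (α : HClass (smash Γ A) X) (β : HClass (smash Γ B) X)
    (γ : HClass (smash Γ C) X) (cA : HomotopyCocommutative (smash Γ A) ∨ IsS0 A)
    (cB : HomotopyCocommutative (smash Γ B) ∨ IsS0 B)
    (cC : HomotopyCocommutative (smash Γ C) ∨ IsS0 C) :
    gpull Γ (s213 A B C) (dotAct β (gammaWhitehead (gammaWhitehead β⁻¹ α) γ)) *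
      gpull Γ (s321 A B C) (dotAct γ (gammaWhitehead (gammaWhitehead γ⁻¹ β) α)) *
      gpull Γ (s132 A B C) (dotAct α (gammaWhitehead (gammaWhitehead α⁻¹ γ) β)) = 1 := by
  have h_b := gpull_dotAct (isCoordinate_pr2 A B C) cB ((hB.smash hA).smash hC)
    (k := (smash3Mk B A C).comp (t213 A B C)) (fun _ h => smash3Mk_eq_pt (Or.inl h)) β
    (gammaWhitehead (gammaWhitehead β⁻¹ α) γ)
  have h_c := gpull_dotAct (isCoordinate_pr3 A B C) cC ((hC.smash hB).smash hA)
    (k := (smash3Mk C B A).comp (t321 A B C)) (fun _ h => smash3Mk_eq_pt (Or.inl h)) γ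
    (gammaWhitehead (gammaWhitehead γ⁻¹ β) α)
  have h_a := gpull_dotAct (isCoordinate_pr1 A B C) cA ((hA.smash hC).smash hB)
    (k := (smash3Mk A C B).comp (t132 A B C)) (fun _ h => smash3Mk_eq_pt (Or.inl h)) α
    (gammaWhitehead (gammaWhitehead α⁻¹ γ) β)
  rw [t213, gpull_smash3Mk_prodLift hB hA hC, gpull_inv] at h_b
  rw [t321, gpull_smash3Mk_prodLift hC hB hA, gpull_inv] at h_c
  rw [t132, gpull_smash3Mk_prodLift hA hC hB, gpull_inv] at h_a
  refine gpull_smash3Mk_injective hA hB hC ?_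
  rw [gpull_mul, gpull_mul, gpull_gpull, gpull_gpull, gpull_gpull, gpull_one]
  exact (congrArg₂ _ (congrArg₂ _ h_b h_c) h_a).trans (hall_witt _ _ _)

end Identities

end GammaFox

theorem theorem4_general (Γ A B C : PTop.{u}) [CoGroup Γ] (X : PTop.{v})
    (hA : HasWellPointedCGType A) (hB : HasWellPointedCGType B) (hC : HasWellPointedCGType C)
    (α : HClass (smash Γ A) X) (β : HClass (smash Γ B) X) (γ : HClass (smash Γ C) X) :
    ((∀ P Q : PTop.{u}, HasWellPointedCGType P → HasWellPointedCGType Q →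
        HasWellPointedCGType (smash P Q) ∧
        ∀ (μ : HClass (smash Γ P) X) (ν : HClass (smash Γ Q) X), ∃! κ, IsGammaWhitehead μ ν κ) ∧
      ∀ W : PTop.{u}, HasWellPointedCGType W →
        ∀ (ξ : HClass (smash Γ S0) X) (η : HClass (smash Γ W) X), ∃! ζ, IsConjAct ξ η ζ) ∧
    (∀ (a : FoxGroup Γ A X) (b : FoxGroup Γ B X) (c : FoxGroup Γ C X)
        (a' b' c' : FoxGroup Γ (prod (prod A B) C) X),
        a = toFox Γ (ContinuousMap.id A) α → b = toFox Γ (ContinuousMap.id B) β →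
        c = toFox Γ (ContinuousMap.id C) γ →
        a' = toFox Γ (pr1 A B C).toMap α → b' = toFox Γ (pr2 A B C).toMap β →
        c' = toFox Γ (pr3 A B C).toMap γ →
        (b' * gpull Γ (plusMap (t213 A B C).toMap) (foxWhitehead (foxWhitehead b⁻¹ a) c) * b'⁻¹) *
          (c' * gpull Γ (plusMap (t321 A B C).toMap) (foxWhitehead (foxWhitehead c⁻¹ b) a) *
            c'⁻¹) *
          (a' * gpull Γ (plusMap (t132 A B C).toMap) (foxWhitehead (foxWhitehead a⁻¹ c) b) *
            a'⁻¹) = 1 ∧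
        foxWhitehead (foxWhitehead b⁻¹ a) c =
          toFox Γ (smash3Mk B A C).toMap (gammaWhitehead (gammaWhitehead β⁻¹ α) γ) ∧
        foxWhitehead (foxWhitehead c⁻¹ b) a =
          toFox Γ (smash3Mk C B A).toMap (gammaWhitehead (gammaWhitehead γ⁻¹ β) α) ∧
        foxWhitehead (foxWhitehead a⁻¹ c) b =
          toFox Γ (smash3Mk A C B).toMap (gammaWhitehead (gammaWhitehead α⁻¹ γ) β)) ∧
    (HomotopyCocommutative (smash Γ A) → HomotopyCocommutative (smash Γ B) →
      HomotopyCocommutative (smash Γ C) →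
        gammaWhitehead (gammaWhitehead α β) γ *
          gpull Γ (s312 A B C) (gammaWhitehead (gammaWhitehead γ α) β) *
          gpull Γ (s231 A B C) (gammaWhitehead (gammaWhitehead β γ) α) = 1) ∧
    (HomotopyCocommutative (smash Γ A) ∨ IsS0 A → HomotopyCocommutative (smash Γ B) ∨ IsS0 B →
      HomotopyCocommutative (smash Γ C) ∨ IsS0 C →
        gpull Γ (s213 A B C) (dotAct β (gammaWhitehead (gammaWhitehead β⁻¹ α) γ)) *
          gpull Γ (s321 A B C) (dotAct γ (gammaWhitehead (gammaWhitehead γ⁻¹ β) α)) *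
          gpull Γ (s132 A B C) (dotAct α (gammaWhitehead (gammaWhitehead α⁻¹ γ) β)) = 1) := by
  refine ⟨⟨fun P Q hP hQ => ⟨hP.smash hQ, existsUnique_isGammaWhitehead hP hQ⟩,
    fun W hW => existsUnique_isConjAct hW⟩, fun a b c a' b' c' ha hb hc ha' hb' hc' => ?_,
    gammaWhitehead_jacobi hA hB hC α β γ, gammaWhitehead_hall_witt hA hB hC α β γ⟩
  have h_hall_witt := foxWhitehead_hall_witt hA hB hC a b c
  subst ha hb hc ha' hb' hc'
  rw [gpull_plusMap_toFox, gpull_plusMap_toFox, gpull_plusMap_toFox] at h_hall_witt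
  refine ⟨h_hall_witt, ?_⟩
  simp only [← toFox_inv]
  exact ⟨foxWhitehead_foxWhitehead_toFox hB hA hC _ _ _,
    foxWhitehead_foxWhitehead_toFox hC hB hA _ _ _,
    foxWhitehead_foxWhitehead_toFox hA hC hB _ _ _⟩

theorem theorem4 (Γ A B C : PTop.{u}) [CoGroup Γ] (X : PTop.{v})
    (hA : HasCGHType A) (hB : HasCGHType B) (hC : HasCGHType C)
    (α : HClass (smash Γ A) X) (β : HClass (smash Γ B) X) (γ : HClass (smash Γ C) X) :
    -- the `Γ`-Whitehead products and the action of `[Γ, X]` are well defined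
    ((∀ P Q : PTop.{u}, HasCGHType P → HasCGHType Q → HasCGHType (smash P Q) ∧
        ∀ (μ : HClass (smash Γ P) X) (ν : HClass (smash Γ Q) X), ∃! κ, IsGammaWhitehead μ ν κ) ∧
      ∀ W : PTop.{u}, HasCGHType W →
        ∀ (ξ : HClass (smash Γ S0) X) (η : HClass (smash Γ W) X), ∃! ζ, IsConjAct ξ η ζ) ∧
    -- (1) the Hall-Witt form in `τ^Γ_{A × B × C}(X)`, where the iterated `Γ`-Whitehead products
    -- of the images of `α, β, γ` are the images of the iterated `Γ`-Whitehead products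
    (∀ (a : FoxGroup Γ A X) (b : FoxGroup Γ B X) (c : FoxGroup Γ C X)
        (a' b' c' : FoxGroup Γ (prod (prod A B) C) X),
        a = toFox Γ (ContinuousMap.id A) α → b = toFox Γ (ContinuousMap.id B) β →
        c = toFox Γ (ContinuousMap.id C) γ →
        a' = toFox Γ (pr1 A B C).toMap α → b' = toFox Γ (pr2 A B C).toMap β →
        c' = toFox Γ (pr3 A B C).toMap γ →
        (b' * gpull Γ (plusMap (t213 A B C).toMap) (foxWhitehead (foxWhitehead b⁻¹ a) c) * b'⁻¹) *
          (c' * gpull Γ (plusMap (t321 A B C).toMap) (foxWhitehead (foxWhitehead c⁻¹ b) a) *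
            c'⁻¹) *
          (a' * gpull Γ (plusMap (t132 A B C).toMap) (foxWhitehead (foxWhitehead a⁻¹ c) b) *
            a'⁻¹) = 1 ∧
        foxWhitehead (foxWhitehead b⁻¹ a) c =
          toFox Γ (smash3Mk B A C).toMap (gammaWhitehead (gammaWhitehead β⁻¹ α) γ) ∧
        foxWhitehead (foxWhitehead c⁻¹ b) a =
          toFox Γ (smash3Mk C B A).toMap (gammaWhitehead (gammaWhitehead γ⁻¹ β) α) ∧
        foxWhitehead (foxWhitehead a⁻¹ c) b =
          toFox Γ (smash3Mk A C B).toMap (gammaWhitehead (gammaWhitehead α⁻¹ γ) β)) ∧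
    -- (2) the Jacobi identity (the group operation is written multiplicatively)
    (HomotopyCocommutative (smash Γ A) → HomotopyCocommutative (smash Γ B) →
      HomotopyCocommutative (smash Γ C) →
        gammaWhitehead (gammaWhitehead α β) γ *
          gpull Γ (s312 A B C) (gammaWhitehead (gammaWhitehead γ α) β) *
          gpull Γ (s231 A B C) (gammaWhitehead (gammaWhitehead β γ) α) = 1) ∧
    -- (3) the mixed form
    (HomotopyCocommutative (smash Γ A) ∨ IsS0 A → HomotopyCocommutative (smash Γ B) ∨ IsS0 B →
      HomotopyCocommutative (smash Γ C) ∨ IsS0 C →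
        gpull Γ (s213 A B C) (dotAct β (gammaWhitehead (gammaWhitehead β⁻¹ α) γ)) *
          gpull Γ (s321 A B C) (dotAct γ (gammaWhitehead (gammaWhitehead γ⁻¹ β) α)) *
          gpull Γ (s132 A B C) (dotAct α (gammaWhitehead (gammaWhitehead α⁻¹ γ) β)) = 1) := by
  obtain ⟨⟨h_smash, h_conj⟩, h⟩ := theorem4_general Γ A B C X hA.hasWellPointedCGType
    hB.hasWellPointedCGType hC.hasWellPointedCGType α β γ
  exact ⟨⟨fun P Q hP hQ => ⟨hP.smash hQ,
    (h_smash P Q hP.hasWellPointedCGType hQ.hasWellPointedCGType).2⟩,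
    fun W hW => h_conj W hW.hasWellPointedCGType⟩, h⟩
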